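/- Let $(W,S)$ be a Coxeter system and let $\theta$ be an involutive automorphism of it, i.e. a group automorphism of $W$ with $\theta^2=\mathrm{id}$ and $\theta(S)=S$ (the identity is allowed). Let $\iota(\theta)=\{\theta(w)w^{-1} : w\in W\}$ be the set of twisted identities, and let $\mathrm{Br}(\iota(\theta))$ be this set with the order induced by the Bruhat order on $W$. A special partial matching (SPM) on a finite poset $P$ with maximum $\hat 1$ and cover relation $\lhd$ is a map $M:P\to P$ such that (i) $M^2=\mathrm{id}$; (ii) $M(\hat 1)\lhd\hat 1$; (iii) for every $x\in P$, $M(x)\lhd x$, $M(x)=x$ or $x\lhd M(x)$; (iv) if $x\lhd y$ and $M(x)\neq y$, then $M(x)<M(y)$. A poset $P$ is a pircon if, for every non-minimal $x\in P$, the order ideal $P_{\le x}=\{y\in P: y\le x\}$ is finite and admits an SPM. Suppose that $\theta$ has the no odd flip (NOF) property: $s\theta(s)$ has even or infinite order for every $s\in S$ with $s\neq\theta(s)$. Then $\mathrm{Br}(\iota(\theta))$ is a pircon. Moreover, whenever $w\in\iota(\theta)$ and $s\in S$ satisfy $ws<w$ in the Bruhat order, the order ideal $\mathrm{Br}(\iota(\theta))_{\le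 w}$ is finite, and $x\mapsto\theta(s)xs$ maps it to itself and is an SPM on it. -/

import Mathlib

/-- A special partial matching on a poset `P` with maximum `⊤`; `⋖` is the cover relation of `P`.
(It is only used for finite `P`, see `IsPircon`.) -/
structure IsSPM {P : Type*} [PartialOrder P] [OrderTop P] (M : P → P) : Prop where
  involutive : ∀ x, M (M x) = x
  top_covBy : M ⊤ ⋖ ⊤
  covBy_or : ∀ x, M x ⋖ x ∨ M x = x ∨ x ⋖ M x
  lt_of_covBy : ∀ x y, x ⋖ y → M x ≠ y → M x < M y

/-- A poset is a pircon if every principal order ideal generated by a non-minimal element is finite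
and admits a special partial matching. -/
def IsPircon (P : Type*) [PartialOrder P] : Prop :=
  ∀ x : P, ¬ IsMin x → Finite (Set.Iic x) ∧ ∃ M : Set.Iic x → Set.Iic x, IsSPM M

namespace CoxeterSystem

variable {B W : Type*} [Group W] {M : CoxeterMatrix B}

/-- An edge of the Bruhat graph: `v = u * t` for a reflection `t`, and `u` is shorter than `v`. -/
def BruhatStep (cs : CoxeterSystem M W) (u v : W) : Prop :=
  (∃ t, cs.IsReflection t ∧ v = u * t) ∧ cs.length u < cs.length v

/-- The Bruhat order on `W`. -/
def BruhatLE (cs : CoxeterSystem M W) (u v : W) : Prop :=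
  Relation.ReflTransGen cs.BruhatStep u v

/-- The strict Bruhat order on `W`. -/
def BruhatLT (cs : CoxeterSystem M W) (u v : W) : Prop :=
  cs.BruhatLE u v ∧ u ≠ v

theorem BruhatLE.eq_or_length_lt {cs : CoxeterSystem M W} {u v : W} (h : cs.BruhatLE u v) :
    u = v ∨ cs.length u < cs.length v := by
  induction h with
  | refl => exact Or.inl rfl
  | tail _ hstep ih =>
    rcases ih with rfl | ih
    · exact Or.inr hstep.2
    · exact Or.inr (ih.trans hstep.2)

/-- The subset `X` of `W`, as a type that carries the order induced by the Bruhat order. -/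
@[ext]
structure Br (cs : CoxeterSystem M W) (X : Set W) where
  val : W
  mem : val ∈ X

instance (cs : CoxeterSystem M W) (X : Set W) : PartialOrder (cs.Br X) where
  le x y := cs.BruhatLE x.val y.val
  le_refl _ := Relation.ReflTransGen.refl
  le_trans _ _ _ h₁ h₂ := Relation.ReflTransGen.trans h₁ h₂
  le_antisymm x y h₁ h₂ := by
    rcases h₁.eq_or_length_lt with h | h
    · exact Br.ext h
    · rcases h₂.eq_or_length_lt with h' | h'
      · exact Br.ext h'.symm
      · exact absurd h' h.asymm

/-- `θ` is an involutive automorphism of the Coxeter system: a group automorphism with `θ² = id`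
that maps the set of simple reflections to itself (`θ = id` is allowed). -/
structure IsInvolutiveAut (cs : CoxeterSystem M W) (θ : W ≃* W) : Prop where
  involutive : ∀ w, θ (θ w) = w
  map_simple : ∀ i, ∃ j, θ (cs.simple i) = cs.simple j

/-- The no odd flip property. -/
def IsNOF (cs : CoxeterSystem M W) (θ : W ≃* W) : Prop :=
  ∀ i, cs.simple i ≠ θ (cs.simple i) →
    Even (orderOf (cs.simple i * θ (cs.simple i))) ∨
      ¬ IsOfFinOrder (cs.simple i * θ (cs.simple i))

end CoxeterSystem

/-- The set of twisted identities `θ(w)w⁻¹`. -/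
def twistedIdentities {W : Type*} [Group W] (θ : W ≃* W) : Set W :=
  {x | ∃ w, x = θ w * w⁻¹}

/-!
For a simple reflection `s`, twisted conjugation `x ↦ θ(s) x s` acts on the twisted identities. On
`x = θ(v) v⁻¹`, the parity of inversions shows that it lowers the length by `2` if `s` is a descent
of `x`, and otherwise raises it by `2` or fixes `x`; the lifting property of the Bruhat order does
the rest, except for one case of condition (iv): if `x ⋖ y`, `s` is a descent of neither, and
twisted conjugation by `s` fixes `y`, then it must fix `x` too.

For that, choose a descent `r` of `y` and let `c` be the shortest element of the orbit of `y` under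
the dihedral group generated by `r` and `s`. The reflection fixing `y` becomes a reflection of the
dihedral group fixing `c`, and it has to be simple, for otherwise `c` could interchange the two
simple reflections. Now either `x` lies above some `x' ⋖ c` in the same way as `y` lies above `c`,
and induction applies, or `x` lies in the orbit of `c`; in the latter case `s` could move `x` only
to `y`, and would then be a descent of `y`. To see that `c` cannot interchange two simple
reflections, untwist it: such a swap reads `θ(t) = r t r ≠ t` for reflections `r = θ(r)` and `t`. By
induction on the length of `r`, this comes down either to a simple `r`, where a length count
excludes it, or to an odd power of some `s θ(s)` with `s ≠ θ(s)` being trivial, which the no odd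
flip property forbids. That covering relations raise the length by exactly `2` follows from the same
case.
-/

namespace CoxeterGroup

variable {B W : Type*} [Group W] {M : CoxeterMatrix B} (cs : CoxeterSystem M W)

local notation "s" => cs.simple
local notation "ℓ" => cs.length

/-! ### Parity of inversions -/

open Classical in
/-- The action of the simple reflection `s i` on pairs of a group element and a sign, where the
sign is recorded in `ZMod 2`: it conjugates the element and flips the sign exactly at `s i`. -/
noncomputable def signedConj (i : B) : Equiv.Perm (W × ZMod 2) :=
  Function.Involutive.toPerm (fun p ↦ (s i * p.1 * s i, p.2 + if p.1 = s i then 1 else 0)) (by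
    rintro ⟨t, ε⟩
    have conj_eq_iff : s i * t * s i = s i ↔ t = s i := by
      rw [mul_eq_right, mul_eq_one_iff_inv_eq, cs.inv_simple, eq_comm]
    ext1
    · simp [mul_assoc]
    · by_cases ht : t = s i <;> simp [conj_eq_iff, ht, add_assoc, CharTwo.add_self_eq_zero])

open Classical in
theorem signedConj_apply (i : B) (t : W) (ε : ZMod 2) :
    signedConj cs i (t, ε) = (s i * t * s i, ε + if t = s i then 1 else 0) := rfl

theorem semiconjBy_simple (i j : B) : SemiconjBy (s j) (s i * s j) (s i * s j)⁻¹ := by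
  simp [SemiconjBy, mul_assoc]

open Classical in
theorem signedConj_mul_pow_apply (i j : B) (k : ℕ) (t : W) (ε : ZMod 2) :
    ((signedConj cs i * signedConj cs j) ^ k) (t, ε) =
      ((s i * s j) ^ k * t * ((s i * s j) ^ k)⁻¹,
        ε + ∑ l ∈ Finset.range (2 * k), if t = s j * (s i * s j) ^ l then 1 else 0) := by
  induction k with
  | zero => simp
  | succ k ih =>
    set g := s i * s j with hg
    have simple_mul_pow : s j * g ^ k = (g ^ k)⁻¹ * s j := by
      rw [← inv_pow]
      exact (semiconjBy_simple cs i j).pow_right k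
    have even_term : g ^ k * t * (g ^ k)⁻¹ = s j ↔ t = s j * g ^ (2 * k) := by
      rw [mul_inv_eq_iff_eq_mul, ← eq_inv_mul_iff_mul_eq, two_mul, pow_add, ← mul_assoc,
        ← mul_assoc, simple_mul_pow]
    have odd_term : s j * (g ^ k * t * (g ^ k)⁻¹) * s j = s i ↔ t = s j * g ^ (2 * k + 1) := by
      have hpow : s j * g ^ (2 * k + 1) = (g ^ k)⁻¹ * (s j * g) * g ^ k := by
        rw [show 2 * k + 1 = k + 1 + k by ring, pow_add, pow_succ, ← mul_assoc, ← mul_assoc,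
          simple_mul_pow]
        simp only [mul_assoc]
      rw [hpow, ← eq_mul_inv_iff_mul_eq, ← eq_inv_mul_iff_mul_eq, cs.inv_simple, ← hg,
        mul_inv_eq_iff_eq_mul, ← eq_inv_mul_iff_mul_eq]
      simp only [mul_assoc]
    rw [pow_succ', Equiv.Perm.mul_apply, ih, Equiv.Perm.mul_apply, signedConj_apply,
      signedConj_apply, show 2 * (k + 1) = 2 * k + 1 + 1 by ring, Finset.sum_range_succ,
      Finset.sum_range_succ]
    simp only [even_term, odd_term]
    ext1
    · simp [pow_succ', hg, mul_assoc]
    · simp [add_assoc]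

-- For `k = M i j`, each term of the sum in `signedConj_mul_pow_apply` occurs twice.
theorem isLiftable_signedConj : M.IsLiftable (signedConj cs) := by
  classical
  intro i j
  ext1 ⟨t, ε⟩
  rw [signedConj_mul_pow_apply, two_mul, Finset.sum_range_add]
  simp [pow_add, CharTwo.add_self_eq_zero]

/-- The action of the Coxeter group on signed elements that extends `signedConj`. -/
noncomputable def signedConjHom : W →* Equiv.Perm (W × ZMod 2) :=
  cs.lift ⟨signedConj cs, isLiftable_signedConj cs⟩

/-- The parity of the number of occurrences of `t` in the right inversion sequence of a word
for `w`; it does not depend on the word, being the sign change of `t` under `signedConjHom`. -/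
noncomputable def inversionParity (w t : W) : ZMod 2 := (signedConjHom cs w (t, 0)).2

theorem signedConjHom_simple (i : B) : signedConjHom cs (s i) = signedConj cs i :=
  cs.lift_apply_simple (isLiftable_signedConj cs) i

open Classical in
theorem signedConjHom_wordProd_apply (ω : List B) (t : W) (ε : ZMod 2) :
    signedConjHom cs (cs.wordProd ω) (t, ε) =
      (cs.wordProd ω * t * (cs.wordProd ω)⁻¹, ε + ((cs.rightInvSeq ω).count t : ZMod 2)) := by
  induction ω with
  | nil => simp
  | cons i ω ih =>
    have conj_eq_iff : cs.wordProd ω * t * (cs.wordProd ω)⁻¹ = s i ↔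
        (cs.wordProd ω)⁻¹ * s i * cs.wordProd ω = t := by
      rw [mul_inv_eq_iff_eq_mul, ← eq_inv_mul_iff_mul_eq, mul_assoc, eq_comm]
    rw [cs.wordProd_cons, map_mul, Equiv.Perm.mul_apply, ih, signedConjHom_simple,
      signedConj_apply, CoxeterSystem.rightInvSeq, List.count_cons]
    ext1
    · simp [mul_assoc]
    · by_cases ht : (cs.wordProd ω)⁻¹ * s i * cs.wordProd ω = t <;>
        simp [conj_eq_iff, ht, add_assoc]

open Classical in
theorem inversionParity_wordProd (ω : List B) (t : W) :
    inversionParity cs (cs.wordProd ω) t = ((cs.rightInvSeq ω).count t : ZMod 2) := by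
  simp [inversionParity, signedConjHom_wordProd_apply]

theorem signedConjHom_apply (w t : W) (ε : ZMod 2) :
    signedConjHom cs w (t, ε) = (w * t * w⁻¹, ε + inversionParity cs w t) := by
  classical
  obtain ⟨ω, rfl⟩ := cs.wordProd_surjective w
  rw [signedConjHom_wordProd_apply, inversionParity_wordProd]

theorem inversionParity_one (t : W) : inversionParity cs 1 t = 0 := by
  simp [inversionParity]

theorem inversionParity_mul (v w t : W) :
    inversionParity cs (v * w) t =
      inversionParity cs w t + inversionParity cs v (w * t * w⁻¹) := by
  conv_lhs =>
    rw [inversionParity, map_mul, Equiv.Perm.mul_apply, signedConjHom_apply, signedConjHom_apply]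
  simp

theorem inversionParity_simple_self (i : B) : inversionParity cs (s i) (s i) = 1 := by
  simp [inversionParity, signedConjHom_simple, signedConj_apply]

variable {cs}

theorem mem_rightInvSeq_of_inversionParity_eq_one {ω : List B} {t : W}
    (h : inversionParity cs (cs.wordProd ω) t = 1) : t ∈ cs.rightInvSeq ω := by
  classical
  by_contra hmem
  rw [inversionParity_wordProd, List.count_eq_zero_of_not_mem hmem] at h
  simp at h

theorem inversionParity_self {t : W} (ht : cs.IsReflection t) : inversionParity cs t t = 1 := by
  obtain ⟨w, i, rfl⟩ := ht
  have hinv := inversionParity_mul cs w w⁻¹ (w * s i * w⁻¹)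
  rw [mul_inv_cancel, inversionParity_one] at hinv
  rw [inversionParity_mul, inversionParity_mul]
  simp only [mul_assoc, inv_mul_cancel, one_mul, mul_one, inv_inv, inv_mul_cancel_left,
    cs.inv_simple, cs.simple_mul_simple_self, inversionParity_simple_self] at hinv ⊢
  rw [add_left_comm, ← hinv, add_zero]

theorem isRightInversion_of_inversionParity_eq_one {w t : W} (h : inversionParity cs w t = 1) :
    cs.IsRightInversion w t := by
  obtain ⟨ω, hω, rfl⟩ := cs.exists_isReduced w
  exact cs.isRightInversion_of_mem_rightInvSeq hω (mem_rightInvSeq_of_inversionParity_eq_one h)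

theorem inversionParity_eq_one_iff {w t : W} :
    inversionParity cs w t = 1 ↔ cs.IsRightInversion w t := by
  refine ⟨isRightInversion_of_inversionParity_eq_one, fun ⟨ht, hlt⟩ ↦ ?_⟩
  have eq_zero_of_ne_one : ∀ a : ZMod 2, a ≠ 1 → a = 0 := by decide
  by_contra hne
  have hmul : inversionParity cs (w * t) t = 1 := by
    rw [inversionParity_mul, inversionParity_self ht, mul_inv_cancel_right,
      eq_zero_of_ne_one _ hne, add_zero]
  exact ht.isRightInversion_mul_left_iff.mp (isRightInversion_of_inversionParity_eq_one hmul)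
    ⟨ht, hlt⟩

theorem isRightInversion_mul_iff {v w t : W} :
    cs.IsRightInversion (v * w) t ↔
      (cs.IsRightInversion w t ↔ ¬ cs.IsRightInversion v (w * t * w⁻¹)) := by
  have add_eq_one_iff : ∀ a b : ZMod 2, a + b = 1 ↔ (a = 1 ↔ ¬ b = 1) := by decide
  simp only [← inversionParity_eq_one_iff, inversionParity_mul, add_eq_one_iff]

theorem mem_rightInvSeq_of_isRightInversion {ω : List B} {t : W}
    (h : cs.IsRightInversion (cs.wordProd ω) t) : t ∈ cs.rightInvSeq ω :=
  mem_rightInvSeq_of_inversionParity_eq_one (inversionParity_eq_one_iff.mpr h)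

theorem isRightInversion_simple_iff {i : B} {t : W} : cs.IsRightInversion (s i) t ↔ t = s i := by
  refine ⟨fun h ↦ ?_, ?_⟩
  · simpa using mem_rightInvSeq_of_isRightInversion (ω := [i]) (by simpa using h)
  · rintro rfl
    exact inversionParity_eq_one_iff.mp (inversionParity_simple_self cs i)

theorem isRightInversion_inv_iff_conj {w t : W} :
    cs.IsRightInversion w⁻¹ t ↔ cs.IsRightInversion w (w⁻¹ * t * w) := by
  have h := isRightInversion_mul_iff (cs := cs) (v := w) (w := w⁻¹) (t := t)
  have not_one : ¬ cs.IsRightInversion 1 t := fun h ↦ by simpa using h.2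
  rw [mul_inv_cancel, inv_inv] at h
  tauto

theorem isRightDescent_mul_iff {v w : W} {i : B} :
    cs.IsRightDescent (v * w) i ↔
      (cs.IsRightDescent w i ↔ ¬ cs.IsRightInversion v (w * s i * w⁻¹)) := by
  simp only [← cs.isRightInversion_simple_iff_isRightDescent, isRightInversion_mul_iff]

theorem eq_simple_of_commute {r : W} {i : B} (hr : cs.IsReflection r) (hcomm : Commute r (s i))
    (hi : cs.IsRightDescent r i) : r = s i := by
  obtain ⟨v, j, rfl⟩ := hr
  set τ := v⁻¹ * s i * v with hτ
  have simple_conj : s j * τ * (s j)⁻¹ = τ := by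
    have h := congrArg (fun x ↦ v⁻¹ * x * v * s j) hcomm.eq
    simpa [hτ, mul_assoc] using h
  have eq_of_eq : τ = s j → v * s j * v⁻¹ = s i := fun h ↦ by rw [← h, hτ]; group
  have inv_iff := isRightInversion_inv_iff_conj (cs := cs) (w := v) (t := s i)
  rw [← cs.isRightInversion_simple_iff_isRightDescent, isRightInversion_mul_iff, inv_inv, ← hτ,
    isRightInversion_mul_iff, simple_conj, isRightInversion_simple_iff] at hi
  tauto

theorem simple_mul_eq_mul_simple_or_of_not_isRightDescent {x : W} {i j : B}
    (hi : ¬ cs.IsRightDescent x i) (hj : ¬ cs.IsLeftDescent x j) :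
    s j * x = x * s i ∨ ℓ (s j * x * s i) = ℓ x + 2 := by
  rw [cs.not_isLeftDescent_iff] at hj
  refine or_iff_not_imp_left.mpr fun hne ↦ ?_
  have not_descent : ¬ cs.IsRightDescent (s j * x) i := by
    rw [isRightDescent_mul_iff, isRightInversion_simple_iff, mul_inv_eq_iff_eq_mul]
    tauto
  rw [cs.not_isRightDescent_iff] at not_descent
  lia

theorem simple_mul_eq_mul_simple_or_of_isRightDescent {x : W} {i j : B}
    (hi : cs.IsRightDescent x i) (hj : cs.IsLeftDescent x j) :
    s j * x = x * s i ∨ ℓ x = ℓ (s j * x * s i) + 2 := by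
  rw [cs.isLeftDescent_iff] at hj
  refine or_iff_not_imp_left.mpr fun hne ↦ ?_
  have descent : cs.IsRightDescent (s j * x) i := by
    rw [isRightDescent_mul_iff, isRightInversion_simple_iff, mul_inv_eq_iff_eq_mul]
    tauto
  rw [cs.isRightDescent_iff] at descent
  lia

theorem isLeftDescent_iff_isRightDescent_of_mul_self {r : W} (hr : r * r = 1) {i : B} :
    cs.IsLeftDescent r i ↔ cs.IsRightDescent r i := by
  rw [← cs.isRightDescent_inv_iff, inv_eq_of_mul_eq_one_right hr]

theorem not_isRightDescent_mul_simple {u : W} {i : B} (h : cs.IsRightDescent u i) :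
    ¬ cs.IsRightDescent (u * s i) i := by
  rwa [← cs.isRightDescent_iff_not_isRightDescent_mul]

/-! ### The Bruhat order -/

theorem bruhatLE_length_le {u v : W} (h : cs.BruhatLE u v) : ℓ u ≤ ℓ v :=
  h.eq_or_length_lt.elim (fun h ↦ h ▸ le_rfl) le_of_lt

theorem eq_of_bruhatLE_of_length_le {u v : W} (h : cs.BruhatLE u v) (hl : ℓ v ≤ ℓ u) : u = v :=
  h.eq_or_length_lt.resolve_right hl.not_gt

theorem bruhatStep_inv {u v : W} (h : cs.BruhatStep u v) : cs.BruhatStep u⁻¹ v⁻¹ := by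
  obtain ⟨⟨t, ht, rfl⟩, hl⟩ := h
  exact ⟨⟨u * t * u⁻¹, ht.conj u, by simp [mul_assoc, ht.inv]⟩, by simpa only [cs.length_inv]⟩

theorem bruhatLE_inv {u v : W} (h : cs.BruhatLE u v) : cs.BruhatLE u⁻¹ v⁻¹ :=
  Relation.ReflTransGen.lift (·⁻¹) (fun _ _ ↦ bruhatStep_inv) _ _ h

theorem length_lt_length_mul_iff {u t : W} (ht : cs.IsReflection t) :
    ℓ u < ℓ (u * t) ↔ ¬ cs.IsRightInversion u t := by
  simp only [CoxeterSystem.IsRightInversion, ht, true_and]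
  exact ⟨fun h ↦ h.not_gt, fun h ↦ (ht.length_mul_left_ne u).symm.lt_of_le (not_lt.mp h)⟩

theorem bruhatStep_mul_simple {u v : W} {i : B} (h : cs.BruhatStep u v) (hne : v ≠ u * s i) :
    cs.BruhatStep (u * s i) (v * s i) := by
  obtain ⟨⟨t, ht, rfl⟩, hl⟩ := h
  have ht' : cs.IsReflection (s i * t * s i) := by simpa using ht.conj (s i)
  have mul_conj : u * t * s i = u * s i * (s i * t * s i) := by simp [mul_assoc]
  have conj_conj : s i * (s i * t * s i) * (s i)⁻¹ = t := by simp [mul_assoc]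
  have conj_ne : s i * t * s i ≠ s i := fun h ↦ hne <| by
    rw [← conj_conj, h, mul_inv_cancel_right]
  rw [length_lt_length_mul_iff ht] at hl
  refine ⟨⟨_, ht', mul_conj⟩, ?_⟩
  rw [mul_conj, length_lt_length_mul_iff ht', isRightInversion_mul_iff, isRightInversion_simple_iff,
    conj_conj]
  tauto

theorem bruhatLE_mul_simple {u : W} {i : B} (h : ¬ cs.IsRightDescent u i) :
    cs.BruhatLE u (u * s i) :=
  .single ⟨⟨_, cs.isReflection_simple i, rfl⟩, by rw [cs.not_isRightDescent_iff] at h; lia⟩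

theorem mul_simple_bruhatLE {u : W} {i : B} (h : cs.IsRightDescent u i) :
    cs.BruhatLE (u * s i) u :=
  .single ⟨⟨_, cs.isReflection_simple i, by simp⟩, h⟩

theorem mul_simple_bruhatLE_of_bruhatLE {u v : W} {i : B} (h : cs.BruhatLE u v)
    (hv : cs.IsRightDescent v i) : cs.BruhatLE (u * s i) v := by
  induction h using Relation.ReflTransGen.head_induction_on with
  | refl => exact mul_simple_bruhatLE hv
  | @head u u' hstep hle ih =>
    by_cases he : u' = u * s i
    · exact he ▸ hle
    · exact .trans (.single (bruhatStep_mul_simple hstep he)) ih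

theorem bruhatLE_mul_simple_of_bruhatLE {u v : W} {i : B} (h : cs.BruhatLE u v)
    (hu : ¬ cs.IsRightDescent u i) : cs.BruhatLE u (v * s i) := by
  induction h with
  | refl => exact bruhatLE_mul_simple hu
  | @tail v' v hle hstep ih =>
    by_cases he : v = v' * s i
    · rwa [he, cs.simple_mul_simple_cancel_right]
    · exact .trans ih (.single (bruhatStep_mul_simple hstep he))

theorem simple_mul_bruhatLE_of_bruhatLE {u v : W} {i : B} (h : cs.BruhatLE u v)
    (hv : cs.IsLeftDescent v i) : cs.BruhatLE (s i * u) v := by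
  simpa using bruhatLE_inv
    (mul_simple_bruhatLE_of_bruhatLE (bruhatLE_inv h) (cs.isRightDescent_inv_iff.mpr hv))

theorem bruhatLE_simple_mul_of_bruhatLE {u v : W} {i : B} (h : cs.BruhatLE u v)
    (hu : ¬ cs.IsLeftDescent u i) : cs.BruhatLE u (s i * v) := by
  simpa using bruhatLE_inv
    (bruhatLE_mul_simple_of_bruhatLE (bruhatLE_inv h) (mt cs.isRightDescent_inv_iff.mp hu))

theorem finite_setOf_bruhatLE (w : W) : {u | cs.BruhatLE u w}.Finite := by
  induction hn : ℓ w using Nat.strong_induction_on generalizing w with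
  | _ n ih =>
  subst hn
  rcases eq_or_ne w 1 with rfl | hw
  · exact (Set.finite_singleton 1).subset fun u hu ↦
      eq_of_bruhatLE_of_length_le hu (by simp)
  · obtain ⟨i, hi⟩ := cs.exists_rightDescent_of_ne_one hw
    have finite_below := ih _ hi (w * s i) rfl
    refine (finite_below.union (finite_below.image (· * s i))).subset fun u hu ↦ ?_
    by_cases hui : cs.IsRightDescent u i
    · exact .inr ⟨u * s i, bruhatLE_mul_simple_of_bruhatLE ((mul_simple_bruhatLE hui).trans hu)
        (not_isRightDescent_mul_simple hui), by simp⟩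
    · exact .inl (bruhatLE_mul_simple_of_bruhatLE hu hui)

/-! ### Parabolic subgroups -/

variable (cs) in
/-- The standard parabolic subgroup of type `J`, generated by the simple reflections `s j`,
`j ∈ J`. -/
def parabolic (J : Set B) : Subgroup W := Subgroup.closure (cs.simple '' J)

variable {J : Set B}

theorem simple_mem_parabolic {j : B} (hj : j ∈ J) : s j ∈ parabolic cs J :=
  Subgroup.subset_closure ⟨j, hj, rfl⟩

theorem conj_mem_parabolic {v t : W} (hv : v ∈ parabolic cs J) (ht : t ∈ parabolic cs J) :
    v * t * v⁻¹ ∈ parabolic cs J :=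
  mul_mem (mul_mem hv ht) (inv_mem hv)

theorem mem_parabolic_of_conj_mem {v t : W} (hv : v ∈ parabolic cs J)
    (ht : v * t * v⁻¹ ∈ parabolic cs J) : t ∈ parabolic cs J := by
  simpa [mul_assoc] using conj_mem_parabolic (inv_mem hv) ht

theorem mem_parabolic_of_isRightInversion {v t : W} (hv : v ∈ parabolic cs J)
    (h : cs.IsRightInversion v t) : t ∈ parabolic cs J := by
  induction hv using Subgroup.closure_induction generalizing t with
  | mem x hx =>
    obtain ⟨j, hj, rfl⟩ := hx
    exact isRightInversion_simple_iff.mp h ▸ simple_mem_parabolic hj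
  | one => simpa using h.2
  | mul x y _ hy ihx ihy =>
    rw [isRightInversion_mul_iff] at h
    by_cases hyt : cs.IsRightInversion y t
    · exact ihy hyt
    · exact mem_parabolic_of_conj_mem hy (ihx (by tauto))
  | inv x hx ih =>
    refine mem_parabolic_of_conj_mem (inv_mem hx) ?_
    rw [inv_inv]
    exact ih (isRightInversion_inv_iff_conj.mp h)

theorem exists_wordProd_eq_of_mem_parabolic {v : W} (hv : v ∈ parabolic cs J) :
    ∃ ω : List B, (∀ k ∈ ω, k ∈ J) ∧ cs.wordProd ω = v := by
  have extend : ∀ x, ∀ y ∈ cs.simple '' J, (∃ ω : List B, (∀ k ∈ ω, k ∈ J) ∧ cs.wordProd ω = x) →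
      ∃ ω : List B, (∀ k ∈ ω, k ∈ J) ∧ cs.wordProd ω = y * x := by
    rintro _ _ ⟨j, hj, rfl⟩ ⟨ω, hω, rfl⟩
    exact ⟨j :: ω, by simpa using ⟨hj, hω⟩, cs.wordProd_cons j ω⟩
  induction hv using Subgroup.closure_induction_left with
  | one => exact ⟨[], by simp⟩
  | mul_left y hy x _ ih => exact extend x y hy ih
  | inv_mul_cancel y hy x _ ih =>
    obtain ⟨j, hj, rfl⟩ := hy
    simpa using extend x _ ⟨j, hj, rfl⟩ ih

theorem exists_isRightDescent_wordProd {ω : List B} (hω : ∀ k ∈ ω, k ∈ J)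
    (hne : cs.wordProd ω ≠ 1) : ∃ j ∈ J, cs.IsRightDescent (cs.wordProd ω) j := by
  induction hn : ω.length using Nat.strong_induction_on generalizing ω with
  | _ n ih =>
  rcases List.eq_nil_or_concat ω with rfl | ⟨ω, b, rfl⟩
  · simp at hne
  simp only [List.concat_eq_append, List.mem_append, List.mem_singleton, or_imp,
    forall_and, forall_eq] at hω
  by_cases hb : cs.IsRightDescent (cs.wordProd (ω.concat b)) b
  · exact ⟨b, hω.2, hb⟩
  have inversion : cs.IsRightInversion (cs.wordProd ω) (s b) := by
    rwa [cs.isRightInversion_simple_iff_isRightDescent,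
      cs.isRightDescent_iff_not_isRightDescent_mul, ← cs.wordProd_concat]
  obtain ⟨k, hk, hkb⟩ := List.getElem_of_mem (mem_rightInvSeq_of_isRightInversion inversion)
  have erase : cs.wordProd (ω.concat b) = cs.wordProd (ω.eraseIdx k) := by
    rw [← cs.wordProd_mul_getD_rightInvSeq, cs.wordProd_concat, List.getD_eq_getElem _ _ hk, hkb]
  rw [erase] at hne ⊢
  have := ω.length_eraseIdx_le k
  exact ih _ (by simp at hn; lia) (fun l hl ↦ hω.1 l (List.mem_of_mem_eraseIdx hl)) hne rfl

theorem exists_isRightDescent_of_mem_parabolic {v : W} (hv : v ∈ parabolic cs J) (hne : v ≠ 1) :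
    ∃ j ∈ J, cs.IsRightDescent v j := by
  obtain ⟨ω, hω, rfl⟩ := exists_wordProd_eq_of_mem_parabolic hv
  exact exists_isRightDescent_wordProd hω hne

theorem exists_isLeftDescent_of_mem_parabolic {v : W} (hv : v ∈ parabolic cs J) (hne : v ≠ 1) :
    ∃ j ∈ J, cs.IsLeftDescent v j := by
  simpa only [cs.isRightDescent_inv_iff] using
    exists_isRightDescent_of_mem_parabolic (inv_mem hv) (inv_ne_one.mpr hne)

theorem exists_eq_simple_of_mem_parabolic {v : W} (hv : v ∈ parabolic cs J) (h : ℓ v = 1) :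
    ∃ j ∈ J, v = s j := by
  obtain ⟨j, hj, hd⟩ := exists_isRightDescent_of_mem_parabolic hv (by rintro rfl; simp at h)
  rw [cs.isRightDescent_iff, h, Nat.add_eq_right, cs.length_eq_zero_iff] at hd
  exact ⟨j, hj, by rw [eq_inv_of_mul_eq_one_left hd, cs.inv_simple]⟩

variable (cs J) in
theorem exists_mul_eq_of_parabolic (w : W) :
    ∃ x, ∃ v ∈ parabolic cs J, w = x * v ∧ ∀ j ∈ J, ¬ cs.IsRightDescent x j := by
  induction hn : ℓ w using Nat.strong_induction_on generalizing w with
  | _ n ih =>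
  subst hn
  by_cases! h : ∀ j ∈ J, ¬ cs.IsRightDescent w j
  · exact ⟨w, 1, one_mem _, by simp, h⟩
  · obtain ⟨j, hj, hd⟩ := h
    obtain ⟨x, v, hv, hw, hx⟩ := ih _ hd _ rfl
    exact ⟨x, v * s j, mul_mem hv (simple_mem_parabolic hj), by simp [← mul_assoc, ← hw], hx⟩

section MinimalCosetRepresentative

variable {c v : W} (hc : ∀ j ∈ J, ¬ cs.IsRightDescent c j)
include hc

theorem not_isRightInversion_of_mem_parabolic {t : W} (ht : t ∈ parabolic cs J) :
    ¬ cs.IsRightInversion c t := by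
  obtain ⟨x, ⟨v, hv, rfl⟩, hx⟩ := WellFounded.has_min (measure cs.length).wf
    {x | ∃ v ∈ parabolic cs J, x = c * v} ⟨c, 1, one_mem _, by simp⟩
  have no_inversion : ∀ t ∈ parabolic cs J, ¬ cs.IsRightInversion (c * v) t :=
    fun t ht h ↦ hx (c * v * t) ⟨v * t, mul_mem hv ht, mul_assoc _ _ _⟩ h.2
  rcases eq_or_ne v 1 with rfl | hv1
  · simpa using no_inversion t ht
  · obtain ⟨j, hj, hd⟩ :=
      exists_isRightDescent_of_mem_parabolic (inv_mem hv) (inv_ne_one.mpr hv1)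
    refine absurd ?_ (hc j hj)
    rw [← mul_inv_cancel_right c v, isRightDescent_mul_iff]
    exact iff_of_true hd
      (no_inversion _ (conj_mem_parabolic (inv_mem hv) (simple_mem_parabolic hj)))

theorem isRightDescent_mul_iff_of_mem_parabolic (hv : v ∈ parabolic cs J) {j : B} (hj : j ∈ J) :
    cs.IsRightDescent (c * v) j ↔ cs.IsRightDescent v j := by
  have := not_isRightInversion_of_mem_parabolic hc
    (conj_mem_parabolic hv (simple_mem_parabolic hj))
  rw [isRightDescent_mul_iff]
  tauto

theorem length_mul_of_mem_parabolic (hv : v ∈ parabolic cs J) : ℓ (c * v) = ℓ c + ℓ v := by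
  induction hn : ℓ v using Nat.strong_induction_on generalizing v with
  | _ n ih =>
  subst hn
  rcases eq_or_ne v 1 with rfl | hv1
  · simp
  · obtain ⟨j, hj, hd⟩ := exists_isRightDescent_of_mem_parabolic hv hv1
    have length_below := ih _ hd (mul_mem hv (simple_mem_parabolic hj)) rfl
    have hd' := (isRightDescent_mul_iff_of_mem_parabolic hc hv hj).mpr hd
    rw [cs.isRightDescent_iff] at hd hd'
    rw [← mul_assoc] at length_below
    lia

end MinimalCosetRepresentative

theorem eq_of_mem_parabolic_pair_of_isRightDescent {i j : B} {v v' : W}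
    (hv : v ∈ parabolic cs {i, j}) (hv' : v' ∈ parabolic cs {i, j}) (hl : ℓ v = ℓ v')
    (hd : cs.IsRightDescent v i) (hd' : cs.IsRightDescent v' i) : v = v' := by
  induction hn : ℓ v using Nat.strong_induction_on generalizing v v' i j with
  | _ n ih =>
  have next_descent : ∀ {x}, x ∈ parabolic cs {i, j} → cs.IsRightDescent x i → x * s i ≠ 1 →
      cs.IsRightDescent (x * s i) j := by
    intro x hx hxi hne
    obtain ⟨k, rfl | rfl, hk⟩ := exists_isRightDescent_of_mem_parabolic
      (mul_mem hx (simple_mem_parabolic (Set.mem_insert i {j}))) hne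
    · exact absurd hk (not_isRightDescent_mul_simple hxi)
    · exact hk
  have hl_below : ℓ (v * s i) = ℓ (v' * s i) := by
    rw [cs.isRightDescent_iff] at hd hd'
    lia
  refine mul_right_cancel (b := s i) ?_
  by_cases h : v * s i = 1
  · rw [h, eq_comm, ← cs.length_eq_zero_iff, ← hl_below, h, cs.length_one]
  · have h' : v' * s i ≠ 1 := by
      rwa [ne_eq, ← cs.length_eq_zero_iff, ← hl_below, cs.length_eq_zero_iff]
    have hj := next_descent hv hd h
    have hj' := next_descent hv' hd' h'
    have hi : s i ∈ parabolic cs {j, i} := simple_mem_parabolic (by simp)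
    rw [Set.pair_comm] at hv hv'
    exact ih _ (hn ▸ hd) (mul_mem hv hi) (mul_mem hv' hi) hl_below hj hj' rfl

theorem exists_zpow_of_mem_closure_pair {G : Type*} [Group G] {a b v : G} (ha : a * a = 1)
    (hb : b * b = 1) (hv : v ∈ Subgroup.closure {a, b}) :
    ∃ k : ℤ, v = (a * b) ^ k ∨ v = (a * b) ^ k * a := by
  have ha' : a⁻¹ = a := inv_eq_of_mul_eq_one_left ha
  have hb' : b⁻¹ = b := inv_eq_of_mul_eq_one_left hb
  have mul_gen : ∀ v, (∃ k : ℤ, v = (a * b) ^ k ∨ v = (a * b) ^ k * a) → ∀ y ∈ ({a, b} : Set G),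
      ∃ k : ℤ, v * y = (a * b) ^ k ∨ v * y = (a * b) ^ k * a := by
    rintro v ⟨k, rfl | rfl⟩ y (rfl | rfl)
    · exact ⟨k, .inr rfl⟩
    · exact ⟨k - 1, .inr (by rw [zpow_sub_one, mul_inv_rev, ha', hb', mul_assoc, mul_assoc, ha,
        mul_one])⟩
    · exact ⟨k, .inl (by rw [mul_assoc, ha, mul_one])⟩
    · exact ⟨k + 1, .inl (by rw [zpow_add_one, mul_assoc])⟩
  induction hv using Subgroup.closure_induction_right with
  | one => exact ⟨0, .inl (by simp)⟩
  | mul_right x _ y hy ih => exact mul_gen x ih y hy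
  | mul_inv_cancel x _ y hy ih =>
    refine mul_gen x ih _ ?_
    rcases hy with rfl | rfl <;> simp [*]

theorem exists_zpow_of_mem_parabolic_pair {i j : B} {v : W} (hv : v ∈ parabolic cs {i, j}) :
    ∃ k : ℤ, v = (s i * s j) ^ k ∨ v = (s i * s j) ^ k * s i := by
  rw [parabolic, Set.image_pair] at hv
  exact exists_zpow_of_mem_closure_pair (cs.simple_mul_simple_self i)
    (cs.simple_mul_simple_self j) hv

theorem not_isReflection_zpow (i j : B) (k : ℤ) : ¬ cs.IsReflection ((s i * s j) ^ k) := by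
  intro h
  have parity := cs.lengthParity_eq_ofAdd_length ((s i * s j) ^ k)
  rw [map_zpow, map_mul, cs.lengthParity_simple, cs.lengthParity_simple] at parity
  have : Multiplicative.ofAdd (1 : ZMod 2) * Multiplicative.ofAdd 1 = 1 := rfl
  rw [this, one_zpow, eq_comm, ofAdd_eq_one, ZMod.natCast_eq_zero_iff_even] at parity
  exact Nat.not_even_iff_odd.mpr h.odd_length parity

theorem isReflection_zpow_mul {r a b : W} (hr : cs.IsReflection r) (ha : a * a = 1)
    (hab : r * a * r = b) (k : ℤ) : cs.IsReflection ((a * b) ^ k * r) := by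
  have ha' : a⁻¹ = a := inv_eq_of_mul_eq_one_left ha
  have mul_r : a * b * r = a * r * a⁻¹ := by
    rw [← hab, ha']
    simp only [mul_assoc, hr.mul_self, mul_one]
  have r_mul (l : ℤ) : r * ((a * b) ^ l)⁻¹ = (a * b) ^ l * r := by
    have inverts : SemiconjBy r (a * b) (a * b)⁻¹ := by
      rw [SemiconjBy, eq_inv_mul_iff_mul_eq, ← mul_assoc, mul_r, ha', ← hab]
      simp only [← mul_assoc]
      simp only [mul_assoc _ a a, ha, one_mul, mul_one, mul_assoc _ r r, hr.mul_self]
    simpa only [zpow_neg, inv_zpow, inv_inv] using (inverts.zpow_right (-l)).eq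
  obtain ⟨l, rfl | rfl⟩ := Int.even_or_odd' k
  · rw [two_mul, zpow_add, mul_assoc, ← r_mul, ← mul_assoc]
    exact hr.conj _
  · rw [two_mul, add_assoc, add_comm l 1, zpow_add, zpow_one_add, mul_assoc, mul_assoc, ← r_mul,
      ← mul_assoc _ r, mul_r, ← mul_assoc]
    exact (hr.conj a).conj _

/-! ### Involutive automorphisms without odd flips -/

variable {θ : W ≃* W}

theorem length_map_le (hθ : cs.IsInvolutiveAut θ) (w : W) : ℓ (θ w) ≤ ℓ w := by
  choose f hf using hθ.map_simple
  have map_wordProd : ∀ ω : List B, θ (cs.wordProd ω) = cs.wordProd (ω.map f) := by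
    intro ω
    induction ω with
    | nil => simp
    | cons i ω ih =>
      rw [cs.wordProd_cons, map_mul, ih, hf, List.map_cons, cs.wordProd_cons]
  obtain ⟨ω, hω, rfl⟩ := cs.exists_isReduced w
  rw [map_wordProd, hω.eq, ← List.length_map (as := ω) f]
  exact cs.length_wordProd_le _

theorem length_map (hθ : cs.IsInvolutiveAut θ) (w : W) : ℓ (θ w) = ℓ w := by
  refine (length_map_le hθ w).antisymm ?_
  simpa only [hθ.involutive] using length_map_le hθ (θ w)

theorem isReflection_map (hθ : cs.IsInvolutiveAut θ) {t : W} (ht : cs.IsReflection t) :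
    cs.IsReflection (θ t) := by
  obtain ⟨w, i, rfl⟩ := ht
  obtain ⟨j, hj⟩ := hθ.map_simple i
  exact ⟨θ w, j, by simp [hj]⟩

theorem isRightDescent_map_iff (hθ : cs.IsInvolutiveAut θ) {i j : B} (hij : θ (s i) = s j)
    {w : W} : cs.IsRightDescent (θ w) j ↔ cs.IsRightDescent w i := by
  rw [CoxeterSystem.IsRightDescent, ← hij, ← map_mul, length_map hθ, length_map hθ]
  rfl

theorem map_simple_comm (hθ : cs.IsInvolutiveAut θ) {i j : B} (hij : θ (s i) = s j) :
    θ (s j) = s i := by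
  rw [← hij, hθ.involutive]

theorem map_mem_parabolic_pair (hθ : cs.IsInvolutiveAut θ) {i j : B} (hij : θ (s i) = s j)
    {v : W} (hv : v ∈ parabolic cs {i, j}) : θ v ∈ parabolic cs {i, j} := by
  have hle : parabolic cs {i, j} ≤ (parabolic cs {i, j}).comap θ.toMonoidHom := by
    refine (Subgroup.closure_le _).mpr ?_
    rintro _ ⟨k, rfl | rfl, rfl⟩
    · simpa [hij] using simple_mem_parabolic (by simp)
    · simpa [map_simple_comm hθ hij] using simple_mem_parabolic (by simp)
  exact hle hv

theorem map_eq_self_of_isRightDescent_pair (hθ : cs.IsInvolutiveAut θ) {i j : B}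
    (hij : θ (s i) = s j) {v : W} (hv : v ∈ parabolic cs {i, j}) (hi : cs.IsRightDescent v i)
    (hj : cs.IsRightDescent v j) : θ v = v :=
  eq_of_mem_parabolic_pair_of_isRightDescent (map_mem_parabolic_pair hθ hij hv) hv (length_map hθ v)
    ((isRightDescent_map_iff hθ (map_simple_comm hθ hij)).mpr hj) hi

theorem zpow_two_mul_add_one_ne_one (hNOF : cs.IsNOF θ) {i : B} (hi : s i ≠ θ (s i)) (k : ℤ) :
    (s i * θ (s i)) ^ (2 * k + 1) ≠ 1 := by
  have even_order : Even (orderOf (s i * θ (s i))) :=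
    (hNOF i hi).elim id fun h ↦ orderOf_eq_zero h ▸ Even.zero
  intro hk
  have two_dvd : (2 : ℤ) ∣ 2 * k + 1 :=
    (Int.natCast_dvd_natCast.mpr even_order.two_dvd).trans (orderOf_dvd_iff_zpow_eq_one.mpr hk)
  lia

theorem map_zpow_simple_mul_simple (hθ : cs.IsInvolutiveAut θ) {i j : B} (hij : θ (s i) = s j)
    (k : ℤ) : θ ((s i * s j) ^ k) = ((s i * s j) ^ k)⁻¹ := by
  rw [map_zpow, map_mul, hij, map_simple_comm hθ hij, ← inv_zpow, mul_inv_rev, cs.inv_simple,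
    cs.inv_simple]

theorem exists_zpow_of_map_eq_self (hNOF : cs.IsNOF θ) (hθ : cs.IsInvolutiveAut θ) {i j : B}
    (hij : θ (s i) = s j) (hne : s i ≠ s j) {v : W} (hv : v ∈ parabolic cs {i, j})
    (hfix : θ v = v) : ∃ k : ℤ, v = (s i * s j) ^ k := by
  obtain ⟨k, rfl | rfl⟩ := exists_zpow_of_mem_parabolic_pair hv
  · exact ⟨k, rfl⟩
  · refine absurd ?_ (hij ▸ zpow_two_mul_add_one_ne_one hNOF (hij ▸ hne) k)
    rw [map_mul, map_zpow_simple_mul_simple hθ hij, hij, inv_mul_eq_iff_eq_mul] at hfix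
    rw [two_mul, add_assoc, zpow_add, zpow_add_one, ← mul_assoc _ (s i), ← mul_assoc, ← hfix,
      cs.simple_mul_simple_self]

theorem commute_zpow_simple {i j b : B} {k : ℤ} (hk : (s i * s j) ^ k * (s i * s j) ^ k = 1)
    (hb : b ∈ ({i, j} : Set B)) : Commute ((s i * s j) ^ k) (s b) := by
  have commute_j : Commute ((s i * s j) ^ k) (s j) := by
    have := (semiconjBy_simple cs i j).zpow_right k
    rw [inv_zpow, inv_eq_of_mul_eq_one_left hk] at this
    exact this.symm
  rcases hb with rfl | rfl
  · have := ((Commute.refl (s b * s j)).zpow_left k).mul_right commute_j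
    rwa [cs.simple_mul_simple_cancel_right] at this
  · exact commute_j

theorem map_eq_self_of_map_eq_simple_conj (hθ : cs.IsInvolutiveAut θ) {t : W} (ht : t * t = 1)
    {i : B} (h : θ t = s i * t * s i) : θ t = t := by
  have eq_of_commute : s i * t = t * s i → θ t = t := fun hc ↦ by
    rw [h, hc, cs.simple_mul_simple_cancel_right]
  have hl := length_map hθ t
  rw [h] at hl
  have left_iff := isLeftDescent_iff_isRightDescent_of_mul_self (cs := cs) ht (i := i)
  by_cases hi : cs.IsRightDescent t i
  · rcases simple_mul_eq_mul_simple_or_of_isRightDescent hi (left_iff.mpr hi) with hc | hlen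
    · exact eq_of_commute hc
    · lia
  · rcases simple_mul_eq_mul_simple_or_of_not_isRightDescent hi (left_iff.not.mpr hi) with
      hc | hlen
    · exact eq_of_commute hc
    · lia

theorem exists_simple_mul_eq_mul_simple {x v : W} (hx : ∀ j ∈ J, ¬ cs.IsRightDescent x j)
    (hv : v ∈ parabolic cs J) (hxv : x * v * (x * v) = 1) {i : B} (hi : i ∈ J)
    (hvi : cs.IsRightDescent v i) (hl : ℓ (x * v) ≤ ℓ (v * x)) : ∃ b ∈ J, s i * x = x * s b := by
  have length_xv := length_mul_of_mem_parabolic hx hv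
  have left_descent : cs.IsLeftDescent (x * v) i := by
    rwa [isLeftDescent_iff_isRightDescent_of_mul_self hxv,
      isRightDescent_mul_iff_of_mem_parabolic hx hv hi]
  have not_left_descent : ¬ cs.IsLeftDescent x i := by
    intro hxi
    have := cs.length_mul_le (v * s i) (s i * x)
    rw [mul_assoc, cs.simple_mul_simple_cancel_left] at this
    rw [cs.isLeftDescent_iff] at hxi
    rw [cs.isRightDescent_iff] at hvi
    lia
  have length_ix := cs.not_isLeftDescent_iff.mp not_left_descent
  obtain ⟨b, hb, hbd⟩ : ∃ b ∈ J, cs.IsRightDescent (s i * x) b := by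
    by_contra! hcon
    have := length_mul_of_mem_parabolic hcon hv
    rw [mul_assoc] at this
    rw [cs.isLeftDescent_iff] at left_descent
    lia
  refine ⟨b, hb, (simple_mul_eq_mul_simple_or_of_not_isRightDescent (hx b hb)
    not_left_descent).resolve_right fun hlen ↦ ?_⟩
  rw [cs.isRightDescent_iff] at hbd
  lia

theorem exists_eq_mul_zpow_of_swap (hNOF : cs.IsNOF θ) (hθ : cs.IsInvolutiveAut θ) {w : W}
    (hfix : θ w = w) {i j : B} (hij : θ (s i) = s j) (hne : s i ≠ s j)
    (hi : cs.IsRightDescent w i) :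
    ∃ x, (∀ b ∈ ({i, j} : Set B), ¬ cs.IsRightDescent x b) ∧
      ∃ k : ℤ, w = x * (s i * s j) ^ k ∧ θ ((s i * s j) ^ k) = (s i * s j) ^ k ∧
        (s i * s j) ^ k ∈ parabolic cs {i, j} ∧ cs.IsRightDescent ((s i * s j) ^ k) i := by
  obtain ⟨x, v, hv, hxv, hx⟩ := exists_mul_eq_of_parabolic cs {i, j} w
  have hj : cs.IsRightDescent w j := hfix ▸ (isRightDescent_map_iff hθ hij).mpr hi
  rw [hxv, isRightDescent_mul_iff_of_mem_parabolic hx hv (by simp)] at hi hj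
  have v_fix : θ v = v := map_eq_self_of_isRightDescent_pair hθ hij hv hi hj
  obtain ⟨k, rfl⟩ := exists_zpow_of_map_eq_self hNOF hθ hij hne hv v_fix
  exact ⟨x, hx, k, hxv, v_fix, hv, hi⟩

theorem exists_shorter_of_swap (hNOF : cs.IsNOF θ) (hθ : cs.IsInvolutiveAut θ) {r : W}
    (hr : cs.IsReflection r) (hfix : θ r = r) {i j : B} (hij : θ (s i) = s j) (hne : s i ≠ s j)
    (hi : cs.IsRightDescent r i) :
    (∃ g, g * g = 1 ∧ θ g = g ∧ ℓ (g * r * g) < ℓ r) ∨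
      ∃ r', cs.IsReflection r' ∧ θ r' = r' ∧ ℓ r' < ℓ r ∧ θ (s i) = r' * s i * r' := by
  obtain ⟨x, hx, k, hxv, v_fix, hv, hvi⟩ := exists_eq_mul_zpow_of_swap hNOF hθ hfix hij hne hi
  set v := (s i * s j) ^ k with hk
  have hvv : v * v = 1 := by
    rw [mul_eq_one_iff_eq_inv, ← map_zpow_simple_mul_simple hθ hij, v_fix]
  have commute_v : ∀ b ∈ ({i, j} : Set B), Commute v (s b) := fun b ↦ commute_zpow_simple hvv
  have hrv : r * v = x := by rw [hxv, mul_assoc, hvv, mul_one]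
  refine or_iff_not_imp_left.mpr fun not_shorter ↦ ?_
  have hl : ℓ (x * v) ≤ ℓ (v * x) := by
    by_contra! hlt
    exact not_shorter ⟨v, hvv, v_fix, by rwa [mul_assoc, hrv, hxv]⟩
  obtain ⟨b, hb, hxb⟩ := exists_simple_mul_eq_mul_simple hx hv
    (by rw [← hxv, hr.mul_self]) (by simp) hvi hl
  have hrb : s i * r = r * s b := by
    rw [hxv, ← mul_assoc, hxb, mul_assoc, ← (commute_v b hb).eq, mul_assoc]
  rcases hb with rfl | rfl
  · rw [eq_simple_of_commute hr hrb.symm hi, hij] at hfix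
    exact absurd hfix.symm hne
  have conj_i : r * s i * r = s b := by rw [mul_assoc, hrb, ← mul_assoc, hr.mul_self, one_mul]
  have hvr : cs.IsReflection (v * r) :=
    isReflection_zpow_mul hr (cs.simple_mul_simple_self i) conj_i k
  have swap : v * r = r * v := by
    rw [← hvr.inv, mul_inv_rev, hr.inv, inv_eq_of_mul_eq_one_left hvv]
  refine ⟨v * r, hvr, by rw [map_mul, v_fix, hfix], ?_, ?_⟩
  · rw [swap, hrv, hxv, length_mul_of_mem_parabolic hx hv]
    exact Nat.lt_add_of_pos_right (Nat.zero_lt_of_lt hvi)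
  · have conj_v : v * s i * v = s i := by
      rw [(commute_v i (by simp)).eq, mul_assoc, hvv, mul_one]
    nth_rewrite 1 [hij, ← conj_i, swap, ← conj_v]
    simp only [mul_assoc]

theorem exists_shorter_of_isReflection (hNOF : cs.IsNOF θ) (hθ : cs.IsInvolutiveAut θ) {r : W}
    (hr : cs.IsReflection r) (hfix : θ r = r) (hne : ∀ i, r ≠ s i) :
    (∃ g, g * g = 1 ∧ θ g = g ∧ ℓ (g * r * g) < ℓ r) ∨
      ∃ r' i, cs.IsReflection r' ∧ θ r' = r' ∧ ℓ r' < ℓ r ∧ θ (s i) = r' * s i * r' ∧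
        s i ≠ θ (s i) := by
  obtain ⟨i, hi⟩ := cs.exists_rightDescent_of_ne_one (w := r) (by
    rintro rfl
    simpa using hr.odd_length)
  obtain ⟨j, hij⟩ := hθ.map_simple i
  by_cases hs : s i = s j
  · refine .inl ⟨s i, cs.simple_mul_simple_self i, hs ▸ hij, ?_⟩
    rcases simple_mul_eq_mul_simple_or_of_isRightDescent hi
      ((isLeftDescent_iff_isRightDescent_of_mul_self hr.mul_self).mpr hi) with hc | hlen
    · exact absurd (eq_simple_of_commute hr hc.symm hi) (hne i)
    · lia
  · exact (exists_shorter_of_swap hNOF hθ hr hfix hij hs hi).imp_right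
      fun ⟨r', hr', hfix', hlt, hconj⟩ ↦ ⟨r', i, hr', hfix', hlt, hconj, hij ▸ hs⟩

theorem map_eq_self_of_map_eq_conj (hNOF : cs.IsNOF θ) (hθ : cs.IsInvolutiveAut θ) {r : W}
    (hr : cs.IsReflection r) (hfix : θ r = r) {t : W} (ht : t * t = 1) (hrt : θ t = r * t * r) :
    θ t = t := by
  induction hn : ℓ r using Nat.strong_induction_on generalizing r t with
  | _ n ih =>
  subst hn
  by_cases! hne : ∃ i, r = s i
  · obtain ⟨i, rfl⟩ := hne
    exact map_eq_self_of_map_eq_simple_conj hθ ht hrt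
  rcases exists_shorter_of_isReflection hNOF hθ hr hfix hne with
    ⟨g, hgg, hg, hlt⟩ | ⟨r', i, hr', hfix', hlt, hconj, hi⟩
  · have isReflection_conj : cs.IsReflection (g * r * g) := by
      simpa only [inv_eq_of_mul_eq_one_left hgg] using hr.conj g
    have conj_mul : ∀ x y, g * x * g * (g * y * g) = g * (x * y) * g := fun x y ↦ by
      simp only [mul_assoc]
      rw [← mul_assoc g g, hgg, one_mul]
    have fixed_conj : θ (g * t * g) = g * t * g := by
      refine ih _ hlt isReflection_conj (by simp [hg, hfix]) ?_ ?_ rfl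
      · rw [conj_mul, ht, mul_one, hgg]
      · rw [conj_mul, conj_mul, map_mul, map_mul, hg, hrt]
    rw [map_mul, map_mul, hg] at fixed_conj
    exact mul_left_cancel (mul_right_cancel fixed_conj)
  · exact absurd (ih _ hlt hr' hfix' (cs.simple_mul_simple_self i) hconj rfl).symm hi

theorem isRightInversion_map_iff (hθ : cs.IsInvolutiveAut θ) {w t : W} :
    cs.IsRightInversion (θ w) (θ t) ↔ cs.IsRightInversion w t := by
  have isReflection_map_iff : cs.IsReflection (θ t) ↔ cs.IsReflection t :=
    ⟨fun h ↦ hθ.involutive t ▸ isReflection_map hθ h, isReflection_map hθ⟩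
  rw [CoxeterSystem.IsRightInversion, ← map_mul, length_map hθ, length_map hθ,
    isReflection_map_iff]
  rfl

/-! ### Twisted conjugation -/

/-- The `θ`-twisted conjugation by `g`. This is an action of `W` on itself, for which
`twistedIdentities θ` is the orbit of `1`. -/
def twistedConj (θ : W ≃* W) (g x : W) : W := θ g * x * g⁻¹

@[simp]
theorem twistedConj_one (x : W) : twistedConj θ 1 x = x := by
  simp [twistedConj]

theorem twistedConj_mul (g h x : W) :
    twistedConj θ (g * h) x = twistedConj θ g (twistedConj θ h x) := by
  simp only [twistedConj, map_mul, mul_inv_rev, mul_assoc]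

theorem twistedConj_eq_self_iff {g x : W} : twistedConj θ g x = x ↔ SemiconjBy x g (θ g) :=
  mul_inv_eq_iff_eq_mul.trans eq_comm

theorem twistedConj_injective (g : W) : Function.Injective (twistedConj θ g) :=
  fun _ _ h ↦ mul_left_cancel (mul_right_cancel h)

theorem twistedConj_conj_eq_self_iff {g v x : W} :
    twistedConj θ (v⁻¹ * g * v) x = x ↔
      twistedConj θ g (twistedConj θ v x) = twistedConj θ v x := by
  rw [← (twistedConj_injective v).eq_iff, ← twistedConj_mul, mul_assoc, mul_inv_cancel_left,
    twistedConj_mul]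

@[simp]
theorem twistedConj_simple_twistedConj_simple (i : B) (x : W) :
    twistedConj θ (s i) (twistedConj θ (s i) x) = x := by
  rw [← twistedConj_mul, cs.simple_mul_simple_self, twistedConj_one]

theorem twistedConj_mem {g x : W} (hx : x ∈ twistedIdentities θ) :
    twistedConj θ g x ∈ twistedIdentities θ := by
  obtain ⟨w, rfl⟩ := hx
  exact ⟨g * w, by simp only [twistedConj, map_mul, mul_inv_rev, mul_assoc]⟩

theorem map_eq_inv (hθ : cs.IsInvolutiveAut θ) {x : W} (hx : x ∈ twistedIdentities θ) :
    θ x = x⁻¹ := by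
  obtain ⟨w, rfl⟩ := hx
  simp [hθ.involutive]

theorem isLeftDescent_iff_of_mem_twistedIdentities (hθ : cs.IsInvolutiveAut θ) {i j : B}
    (hij : θ (s i) = s j) {x : W} (hx : x ∈ twistedIdentities θ) :
    cs.IsLeftDescent x j ↔ cs.IsRightDescent x i := by
  rw [← cs.isRightDescent_inv_iff, ← map_eq_inv hθ hx, isRightDescent_map_iff hθ hij]

theorem twistedConj_simple {i j : B} (hij : θ (s i) = s j) (x : W) :
    twistedConj θ (s i) x = s j * x * s i := by
  rw [twistedConj, hij, cs.inv_simple]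

theorem semiconjBy_map_mul_inv_iff {v x y : W} :
    SemiconjBy (θ v * v⁻¹) x (θ y) ↔ θ (v⁻¹ * y * v) = v⁻¹ * x * v := by
  rw [SemiconjBy, ← mul_assoc, eq_mul_inv_iff_mul_eq, eq_comm, map_mul, map_mul, map_inv]
  simp only [mul_assoc, inv_mul_eq_iff_eq_mul]

theorem twistedConj_ne_self_of_isRightDescent (hθ : cs.IsInvolutiveAut θ) {x : W} {i : B}
    (hx : x ∈ twistedIdentities θ) (hi : cs.IsRightDescent x i) : twistedConj θ (s i) x ≠ x := by
  obtain ⟨v, rfl⟩ := hx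
  intro hfix
  have map_conj := semiconjBy_map_mul_inv_iff.mp (twistedConj_eq_self_iff.mp hfix)
  -- By `map_conj`, `v⁻¹` and `θ v` contribute equally to the parity of `s i` in `θ v * v⁻¹`.
  rw [← cs.isRightInversion_simple_iff_isRightDescent, isRightInversion_mul_iff, inv_inv,
    isRightInversion_inv_iff_conj, ← isRightInversion_map_iff hθ, map_conj] at hi
  tauto

theorem length_twistedConj_of_not_isRightDescent (hθ : cs.IsInvolutiveAut θ) {x : W} {i : B}
    (hx : x ∈ twistedIdentities θ) (hi : ¬ cs.IsRightDescent x i)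
    (hne : twistedConj θ (s i) x ≠ x) : ℓ (twistedConj θ (s i) x) = ℓ x + 2 := by
  obtain ⟨j, hij⟩ := hθ.map_simple i
  have hj := (isLeftDescent_iff_of_mem_twistedIdentities hθ hij hx).not.mpr hi
  rw [twistedConj_simple hij]
  refine (simple_mul_eq_mul_simple_or_of_not_isRightDescent hi hj).resolve_left fun h ↦ hne ?_
  rw [twistedConj_eq_self_iff, hij]
  exact h.symm

theorem length_eq_of_isRightDescent (hθ : cs.IsInvolutiveAut θ) {x : W} {i : B}
    (hx : x ∈ twistedIdentities θ) (hi : cs.IsRightDescent x i) :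
    ℓ x = ℓ (twistedConj θ (s i) x) + 2 := by
  obtain ⟨j, hij⟩ := hθ.map_simple i
  have hj := (isLeftDescent_iff_of_mem_twistedIdentities hθ hij hx).mpr hi
  rw [twistedConj_simple hij]
  refine (simple_mul_eq_mul_simple_or_of_isRightDescent hi hj).resolve_left fun h ↦
    twistedConj_ne_self_of_isRightDescent hθ hx hi ?_
  rw [twistedConj_eq_self_iff, hij]
  exact h.symm

theorem not_isRightDescent_twistedConj (hθ : cs.IsInvolutiveAut θ) {x : W} {i : B}
    (hx : x ∈ twistedIdentities θ) (hi : cs.IsRightDescent x i) :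
    ¬ cs.IsRightDescent (twistedConj θ (s i) x) i := by
  intro h
  have := length_eq_of_isRightDescent hθ (twistedConj_mem hx) h
  rw [twistedConj_simple_twistedConj_simple, length_eq_of_isRightDescent hθ hx hi] at this
  lia

theorem isRightDescent_twistedConj (hθ : cs.IsInvolutiveAut θ) {x : W} {i : B}
    (hx : x ∈ twistedIdentities θ) (hi : ¬ cs.IsRightDescent x i)
    (hne : twistedConj θ (s i) x ≠ x) : cs.IsRightDescent (twistedConj θ (s i) x) i := by
  by_contra h
  have := length_twistedConj_of_not_isRightDescent hθ (twistedConj_mem hx) h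
    (by simpa using hne.symm)
  rw [twistedConj_simple_twistedConj_simple,
    length_twistedConj_of_not_isRightDescent hθ hx hi hne] at this
  lia

theorem twistedConj_bruhatLE (hθ : cs.IsInvolutiveAut θ) {x y : W} {i : B}
    (hy : y ∈ twistedIdentities θ) (h : cs.BruhatLE x y) (hi : cs.IsRightDescent y i) :
    cs.BruhatLE (twistedConj θ (s i) x) y := by
  obtain ⟨j, hij⟩ := hθ.map_simple i
  rw [twistedConj_simple hij, mul_assoc]
  exact simple_mul_bruhatLE_of_bruhatLE (mul_simple_bruhatLE_of_bruhatLE h hi)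
    ((isLeftDescent_iff_of_mem_twistedIdentities hθ hij hy).mpr hi)

theorem bruhatLE_twistedConj (hθ : cs.IsInvolutiveAut θ) {x y : W} {i : B}
    (hx : x ∈ twistedIdentities θ) (h : cs.BruhatLE x y) (hi : ¬ cs.IsRightDescent x i) :
    cs.BruhatLE x (twistedConj θ (s i) y) := by
  obtain ⟨j, hij⟩ := hθ.map_simple i
  rw [twistedConj_simple hij, mul_assoc]
  exact bruhatLE_simple_mul_of_bruhatLE (bruhatLE_mul_simple_of_bruhatLE h hi)
    ((isLeftDescent_iff_of_mem_twistedIdentities hθ hij hx).not.mpr hi)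

theorem twistedConj_bruhatLE_self (hθ : cs.IsInvolutiveAut θ) {x : W} {i : B}
    (hx : x ∈ twistedIdentities θ) (hi : cs.IsRightDescent x i) :
    cs.BruhatLE (twistedConj θ (s i) x) x :=
  twistedConj_bruhatLE hθ hx .refl hi

theorem bruhatLE_twistedConj_self (hθ : cs.IsInvolutiveAut θ) {x : W} {i : B}
    (hx : x ∈ twistedIdentities θ) (hi : ¬ cs.IsRightDescent x i) :
    cs.BruhatLE x (twistedConj θ (s i) x) :=
  bruhatLE_twistedConj hθ hx .refl hi

theorem twistedConj_bruhatLE_twistedConj_of_isRightDescent (hθ : cs.IsInvolutiveAut θ) {x y : W}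
    {i : B} (hx : x ∈ twistedIdentities θ) (h : cs.BruhatLE x y) (hi : cs.IsRightDescent x i) :
    cs.BruhatLE (twistedConj θ (s i) x) (twistedConj θ (s i) y) :=
  bruhatLE_twistedConj hθ (twistedConj_mem hx) ((twistedConj_bruhatLE_self hθ hx hi).trans h)
    (not_isRightDescent_twistedConj hθ hx hi)

theorem twistedConj_bruhatLE_twistedConj_of_not_isRightDescent (hθ : cs.IsInvolutiveAut θ)
    {x y : W} {i : B} (hy : y ∈ twistedIdentities θ) (h : cs.BruhatLE x y)
    (hi : ¬ cs.IsRightDescent y i) (hne : twistedConj θ (s i) y ≠ y) :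
    cs.BruhatLE (twistedConj θ (s i) x) (twistedConj θ (s i) y) :=
  twistedConj_bruhatLE hθ (twistedConj_mem hy) (h.trans (bruhatLE_twistedConj_self hθ hy hi))
    (isRightDescent_twistedConj hθ hy hi hne)

theorem length_twistedConj_le (hθ : cs.IsInvolutiveAut θ) (u c : W) :
    ℓ (twistedConj θ u c) ≤ ℓ c + 2 * ℓ u := by
  have h₁ := cs.length_mul_le (θ u * c) u⁻¹
  have h₂ := cs.length_mul_le (θ u) c
  rw [length_map hθ] at h₂
  rw [cs.length_inv] at h₁
  rw [twistedConj]
  lia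

theorem exists_twistedConj_of_parabolic (hθ : cs.IsInvolutiveAut θ) (J : Set B) {z : W}
    (hz : z ∈ twistedIdentities θ) :
    ∃ c ∈ twistedIdentities θ, (∀ j ∈ J, ¬ cs.IsRightDescent c j) ∧
      ∃ u ∈ parabolic cs J, z = twistedConj θ u c ∧ ℓ z = ℓ c + 2 * ℓ u := by
  induction hn : ℓ z using Nat.strong_induction_on generalizing z with
  | _ n ih =>
  subst hn
  by_cases! h : ∀ j ∈ J, ¬ cs.IsRightDescent z j
  · exact ⟨z, hz, h, 1, one_mem _, by simp, by simp⟩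
  obtain ⟨j, hj, hzj⟩ := h
  have length_z := length_eq_of_isRightDescent hθ hz hzj
  obtain ⟨c, hc, hcJ, u, hu, hzu, hl⟩ := ih _ (by lia) (twistedConj_mem (g := s j) hz) rfl
  have z_eq : z = twistedConj θ (s j * u) c := by
    rw [twistedConj_mul, ← hzu, twistedConj_simple_twistedConj_simple]
  refine ⟨c, hc, hcJ, s j * u, mul_mem (simple_mem_parabolic hj) hu, z_eq, ?_⟩
  have h₁ := z_eq ▸ length_twistedConj_le hθ (s j * u) c
  have h₂ := cs.length_mul_le (s j) u
  rw [cs.length_simple] at h₂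
  lia

theorem twistedConj_ne_self_of_length_eq (hθ : cs.IsInvolutiveAut θ) {c u : W} {p : B}
    (hl : ℓ (twistedConj θ u c) = ℓ c + 2 * ℓ u) (hp : cs.IsRightDescent u p) :
    twistedConj θ (s p) c ≠ c := by
  intro hfix
  have := length_twistedConj_le hθ (u * s p) c
  rw [twistedConj_mul, hfix, hl] at this
  rw [cs.isRightDescent_iff] at hp
  lia

theorem isRightDescent_of_length_eq (hθ : cs.IsInvolutiveAut θ) {c u : W} {k : B}
    (hc : c ∈ twistedIdentities θ) (hl : ℓ (twistedConj θ u c) = ℓ c + 2 * ℓ u)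
    (hk : cs.IsLeftDescent u k) : cs.IsRightDescent (twistedConj θ u c) k := by
  by_contra h
  have le := bruhatLE_length_le (bruhatLE_twistedConj_self hθ (twistedConj_mem hc) h)
  have := length_twistedConj_le hθ (s k * u) c
  rw [twistedConj_mul] at this
  rw [cs.isLeftDescent_iff] at hk
  lia

theorem eq_of_mem_parabolic_pair_of_length_twistedConj (hθ : cs.IsInvolutiveAut θ) {c u v : W}
    {p q : B} (hq : twistedConj θ (s q) c = c) (hu : u ∈ parabolic cs {p, q})
    (hv : v ∈ parabolic cs {p, q}) (hcu : ℓ (twistedConj θ u c) = ℓ c + 2 * ℓ u)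
    (hcv : ℓ (twistedConj θ v c) = ℓ c + 2 * ℓ v) (hl : ℓ u = ℓ v) : u = v := by
  have isRightDescent_p : ∀ w ∈ parabolic cs {p, q}, w ≠ 1 →
      ℓ (twistedConj θ w c) = ℓ c + 2 * ℓ w → cs.IsRightDescent w p := by
    intro w hw hne hcw
    obtain ⟨k, rfl | rfl, hk⟩ := exists_isRightDescent_of_mem_parabolic hw hne
    · exact hk
    · exact absurd hq (twistedConj_ne_self_of_length_eq hθ hcw hk)
  by_cases hu1 : u = 1
  · rw [hu1, cs.length_one, eq_comm, cs.length_eq_zero_iff] at hl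
    rw [hu1, hl]
  · have hv1 : v ≠ 1 := fun h ↦ hu1 (cs.length_eq_zero_iff.mp (by rw [hl, h, cs.length_one]))
    exact eq_of_mem_parabolic_pair_of_isRightDescent hu hv hl (isRightDescent_p u hu hu1 hcu)
      (isRightDescent_p v hv hv1 hcv)

theorem exists_parallel_of_bruhatLE_twistedConj (hθ : cs.IsInvolutiveAut θ) {x c u : W}
    (hx : x ∈ twistedIdentities θ) (hc : c ∈ twistedIdentities θ) (hu : u ∈ parabolic cs J)
    (hle : cs.BruhatLE x (twistedConj θ u c)) (hl : ℓ (twistedConj θ u c) = ℓ c + 2 * ℓ u)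
    (hlx : ℓ (twistedConj θ u c) = ℓ x + 2) :
    (∃ x' ∈ twistedIdentities θ, x = twistedConj θ u x' ∧ cs.BruhatLE x' c ∧ ℓ c = ℓ x' + 2) ∨
      ∃ v ∈ parabolic cs J, x = twistedConj θ v c ∧ ℓ x = ℓ c + 2 * ℓ v := by
  -- Go down from `twistedConj θ u c` along a reduced word for `u`, and take `x` along while the
  -- letters are descents of it.
  induction hn : ℓ u using Nat.strong_induction_on generalizing u x with
  | _ n ih =>
  subst hn
  by_cases hu1 : u = 1
  · subst hu1
    rw [twistedConj_one] at hle hlx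
    exact .inl ⟨x, hx, (twistedConj_one x).symm, hle, hlx⟩
  obtain ⟨k, hk, huk⟩ := exists_isLeftDescent_of_mem_parabolic hu hu1
  have descent := isRightDescent_of_length_eq hθ hc hl huk
  have length_z := length_eq_of_isRightDescent hθ (twistedConj_mem hc) descent
  have length_u := cs.isLeftDescent_iff.mp huk
  have hku := mul_mem (simple_mem_parabolic hk) hu
  rw [← twistedConj_mul] at length_z
  by_cases hxk : cs.IsRightDescent x k
  · have length_x := length_eq_of_isRightDescent hθ hx hxk
    have below := twistedConj_bruhatLE_twistedConj_of_isRightDescent hθ hx hle hxk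
    rw [← twistedConj_mul] at below
    rcases ih _ (by lia) (twistedConj_mem hx) hku below (by lia) (by lia) rfl with
      ⟨x', hx', hxx', hle', hl'⟩ | ⟨v, hv, hxv, hlv⟩
    · rw [twistedConj_mul] at hxx'
      exact .inl ⟨x', hx', twistedConj_injective _ hxx', hle', hl'⟩
    · have x_eq : x = twistedConj θ (s k * v) c := by
        rw [twistedConj_mul, ← hxv, twistedConj_simple_twistedConj_simple]
      refine .inr ⟨s k * v, mul_mem (simple_mem_parabolic hk) hv, x_eq, ?_⟩
      have h₁ := x_eq ▸ length_twistedConj_le hθ (s k * v) c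
      have h₂ := cs.length_mul_le (s k) v
      rw [cs.length_simple] at h₂
      lia
  · refine .inr ⟨s k * u, hku, ?_, by lia⟩
    have below := bruhatLE_twistedConj hθ hx hle hxk
    rw [← twistedConj_mul] at below
    exact eq_of_bruhatLE_of_length_le below (by lia)

/-! ### Dihedral orbits -/

theorem exists_semiconjBy_simple (hθ : cs.IsInvolutiveAut θ) {c r : W}
    (hc : c ∈ twistedIdentities θ) (hcJ : ∀ j ∈ J, ¬ cs.IsRightDescent c j)
    (hr : r ∈ parabolic cs J) (hne : r ≠ 1) (hfix : twistedConj θ r c = c) :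
    ∃ b ∈ J, ∃ d ∈ J, cs.IsRightDescent r b ∧ SemiconjBy c (s b) (θ (s d)) := by
  obtain ⟨b, hb, hrb⟩ := exists_isRightDescent_of_mem_parabolic hr hne
  set d := θ (c * s b * c⁻¹)
  have map_d : θ d = c * s b * c⁻¹ := hθ.involutive _
  have isRightInversion_d : cs.IsRightInversion r d := by
    have h := (isRightDescent_mul_iff_of_mem_parabolic hcJ hr hb).mpr hrb
    rw [(twistedConj_eq_self_iff.mp hfix).eq, isRightDescent_mul_iff] at h
    rw [← isRightInversion_map_iff hθ, map_d]
    exact not_not.mp (h.not.mp (hcJ b hb))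
  have d_mem := mem_parabolic_of_isRightInversion hr isRightInversion_d
  have semiconj : SemiconjBy c (s b) (θ d) := by rw [SemiconjBy, map_d, inv_mul_cancel_right]
  have length_d : ℓ d = 1 := by
    have : ℓ (θ d * c) = ℓ c + ℓ d := by
      rw [← cs.length_inv d, ← length_mul_of_mem_parabolic hcJ (inv_mem d_mem), ← cs.length_inv,
        mul_inv_rev, ← map_eq_inv hθ hc, ← map_inv, ← map_mul, length_map hθ]
    rw [← semiconj.eq, cs.not_isRightDescent_iff.mp (hcJ b hb)] at this
    lia
  obtain ⟨k, hk, hdk⟩ := exists_eq_simple_of_mem_parabolic d_mem length_d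
  exact ⟨b, hb, k, hk, hrb, hdk ▸ semiconj⟩

theorem conj_eq_of_semiconjBy_swap {c r : W} {p q : B} (hr : cs.IsReflection r)
    (hrm : r ∈ parabolic cs {p, q}) (hfix : twistedConj θ r c = c)
    (hpq : SemiconjBy c (s p) (θ (s q))) (hqp : SemiconjBy c (s q) (θ (s p))) :
    r * s p * r = s q := by
  obtain ⟨k, hk⟩ := exists_zpow_of_mem_parabolic_pair hrm
  have r_eq : r = (s p * s q) ^ k * s p :=
    hk.resolve_left fun h ↦ not_isReflection_zpow p q k (h ▸ hr)
  have r_eq_swap : r = (s q * s p) ^ k * s q := by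
    have swap : SemiconjBy c r (θ ((s q * s p) ^ k * s q)) := by
      rw [r_eq, map_mul, map_zpow, map_mul]
      exact ((hpq.mul_right hqp).zpow_right k).mul_right hpq
    have fixed := twistedConj_eq_self_iff.mp hfix
    exact θ.injective (mul_right_cancel (fixed.eq.symm.trans swap.eq))
  have inv_eq : s q * s p = (s p * s q)⁻¹ := by simp
  nth_rewrite 2 [r_eq_swap]
  rw [r_eq, inv_eq, inv_zpow, cs.simple_mul_simple_cancel_right, mul_inv_cancel_left]

theorem simple_eq_of_semiconjBy_swap (hNOF : cs.IsNOF θ) (hθ : cs.IsInvolutiveAut θ) {c r : W}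
    {p q : B} (hc : c ∈ twistedIdentities θ) (hr : cs.IsReflection r)
    (hrm : r ∈ parabolic cs {p, q}) (hfix : twistedConj θ r c = c)
    (hpq : SemiconjBy c (s p) (θ (s q))) : s p = s q := by
  have hqp : SemiconjBy c (s q) (θ (s p)) := by
    have := congrArg (θ ·⁻¹) hpq.eq
    simp only [mul_inv_rev, map_mul, map_inv, map_eq_inv hθ hc, hθ.involutive, inv_inv,
      cs.inv_simple] at this
    exact this.symm
  have conj_p := conj_eq_of_semiconjBy_swap hr hrm hfix hpq hqp
  -- Conjugation by `v` turns the swap of `s p` and `s q` by `θ v * v⁻¹` into an instance of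
  -- `map_eq_self_of_map_eq_conj`.
  obtain ⟨v, rfl⟩ := hc
  have map_conj_r := semiconjBy_map_mul_inv_iff.mp (twistedConj_eq_self_iff.mp hfix)
  have map_conj_p := semiconjBy_map_mul_inv_iff.mp hqp
  have conj_r : cs.IsReflection (v⁻¹ * r * v) := by simpa only [inv_inv] using hr.conj v⁻¹
  have fixed_conj_p : θ (v⁻¹ * s p * v) = v⁻¹ * s p * v := by
    refine map_eq_self_of_map_eq_conj hNOF hθ conj_r map_conj_r ?_ ?_
    · simp [mul_assoc]
    · rw [map_conj_p, ← conj_p]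
      simp [mul_assoc]
  rw [map_conj_p] at fixed_conj_p
  exact (mul_left_cancel (mul_right_cancel fixed_conj_p)).symm

theorem isRightDescent_of_twistedConj_eq_self (hNOF : cs.IsNOF θ) (hθ : cs.IsInvolutiveAut θ)
    {c r : W} {p q : B} (hc : c ∈ twistedIdentities θ)
    (hcJ : ∀ j ∈ ({p, q} : Set B), ¬ cs.IsRightDescent c j) (hp : twistedConj θ (s p) c ≠ c)
    (hr : cs.IsReflection r) (hrm : r ∈ parabolic cs {p, q}) (hfix : twistedConj θ r c = c) :
    cs.IsRightDescent r q ∧ twistedConj θ (s q) c = c := by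
  have hne : r ≠ 1 := by
    rintro rfl
    simpa using hr.odd_length
  obtain ⟨b, hb, d, hd, hrb, hbd⟩ := exists_semiconjBy_simple hθ hc hcJ hrm hne hfix
  have simple_eq : s b = s d := by
    rcases hb with rfl | rfl <;> rcases hd with rfl | rfl
    · rfl
    · exact simple_eq_of_semiconjBy_swap hNOF hθ hc hr hrm hfix hbd
    · exact simple_eq_of_semiconjBy_swap hNOF hθ hc hr (Set.pair_comm _ _ ▸ hrm) hfix hbd
    · rfl
  have fixed_b : twistedConj θ (s b) c = c := twistedConj_eq_self_iff.mpr (simple_eq ▸ hbd)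
  rcases hb with rfl | rfl
  · exact absurd fixed_b hp
  · exact ⟨hrb, fixed_b⟩

theorem eq_simple_of_twistedConj_eq_self (hNOF : cs.IsNOF θ) (hθ : cs.IsInvolutiveAut θ)
    {c r : W} {p q : B} (hc : c ∈ twistedIdentities θ)
    (hcJ : ∀ j ∈ ({p, q} : Set B), ¬ cs.IsRightDescent c j) (hp : twistedConj θ (s p) c ≠ c)
    (hr : cs.IsReflection r) (hrm : r ∈ parabolic cs {p, q}) (hfix : twistedConj θ r c = c) :
    r = s q ∧ twistedConj θ (s q) c = c := by
  obtain ⟨hrq, hqc⟩ := isRightDescent_of_twistedConj_eq_self hNOF hθ hc hcJ hp hr hrm hfix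
  refine ⟨?_, hqc⟩
  rcases simple_mul_eq_mul_simple_or_of_isRightDescent hrq
    ((isLeftDescent_iff_isRightDescent_of_mul_self hr.mul_self).mpr hrq) with hcomm | hlen
  · exact eq_simple_of_commute hr hcomm.symm hrq
  · -- Otherwise `s q * r * s q` also fixes `c`, but it does not have the descent `q`.
    have q_mem : s q ∈ parabolic cs {p, q} := simple_mem_parabolic (by simp)
    have conj_fix : twistedConj θ (s q * r * s q) c = c := by
      rw [twistedConj_mul, twistedConj_mul, hqc, hfix, hqc]
    have conj_descent := (isRightDescent_of_twistedConj_eq_self hNOF hθ hc hcJ hp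
      (by simpa using hr.conj (s q)) (mul_mem (mul_mem q_mem hrm) q_mem) conj_fix).1
    rw [cs.isRightDescent_iff, cs.simple_mul_simple_cancel_right] at conj_descent
    have := cs.length_simple_mul r q
    lia

theorem exists_twistedConj_of_pair (hθ : cs.IsInvolutiveAut θ) {z : W}
    (hz : z ∈ twistedIdentities θ) (hne : z ≠ 1) (i : B) :
    ∃ c ∈ twistedIdentities θ, ∃ p q, (∀ j ∈ ({p, q} : Set B), ¬ cs.IsRightDescent c j) ∧
      i ∈ ({p, q} : Set B) ∧ ∃ u ∈ parabolic cs {p, q}, cs.IsRightDescent u p ∧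
        z = twistedConj θ u c ∧ ℓ z = ℓ c + 2 * ℓ u := by
  obtain ⟨j, hj⟩ := cs.exists_rightDescent_of_ne_one hne
  obtain ⟨c, hc, hcJ, u, hu, hzu, hlu⟩ := exists_twistedConj_of_parabolic hθ {i, j} hz
  have u_ne_one : u ≠ 1 := by
    rintro rfl
    rw [twistedConj_one] at hzu
    exact hcJ j (by simp) (hzu ▸ hj)
  obtain ⟨p, hp, hup⟩ := exists_isRightDescent_of_mem_parabolic hu u_ne_one
  obtain ⟨q, hpq⟩ : ∃ q, ({i, j} : Set B) = {p, q} := by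
    rcases hp with rfl | rfl
    · exact ⟨j, rfl⟩
    · exact ⟨i, Set.pair_comm _ _⟩
  rw [hpq] at hcJ hu
  exact ⟨c, hc, p, q, hcJ, hpq ▸ Set.mem_insert i {j}, u, hu, hup, hzu, hlu⟩

theorem twistedConj_simple_eq_self_of_bruhatLE (hNOF : cs.IsNOF θ) (hθ : cs.IsInvolutiveAut θ)
    {x z : W} {i : B} (hx : x ∈ twistedIdentities θ) (hz : z ∈ twistedIdentities θ)
    (hle : cs.BruhatLE x z) (hl : ℓ z = ℓ x + 2) (hxi : ¬ cs.IsRightDescent x i)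
    (hzi : ¬ cs.IsRightDescent z i) (hfix : twistedConj θ (s i) z = z) :
    twistedConj θ (s i) x = x := by
  induction hn : ℓ z using Nat.strong_induction_on generalizing x z i with
  | _ n ih =>
  subst hn
  by_contra hxne
  have length_ix := length_twistedConj_of_not_isRightDescent hθ hx hxi hxne
  have z_ne_one : z ≠ 1 := by
    rintro rfl
    rw [cs.length_one] at hl
    lia
  obtain ⟨c, hc, p, q, hcJ, hi, u, hu, hup, rfl, hlu⟩ :=
    exists_twistedConj_of_pair hθ hz z_ne_one i
  have i_mem : s i ∈ parabolic cs {p, q} := simple_mem_parabolic hi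
  obtain ⟨conj_eq, hqc⟩ : u⁻¹ * s i * u = s q ∧ twistedConj θ (s q) c = c :=
    eq_simple_of_twistedConj_eq_self hNOF hθ hc hcJ (twistedConj_ne_self_of_length_eq hθ hlu hup)
      (by simpa only [inv_inv] using (cs.isReflection_simple i).conj u⁻¹)
      (mul_mem (mul_mem (inv_mem hu) i_mem) hu) (twistedConj_conj_eq_self_iff.mpr hfix)
  rcases exists_parallel_of_bruhatLE_twistedConj hθ hx hc hu hle hlu hl with
    ⟨x', hx', rfl, hle', hl'⟩ | ⟨v, hv, rfl, hlv⟩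
  · rw [← twistedConj_conj_eq_self_iff.not, conj_eq] at hxne
    refine hxne (ih _ ?_ hx' hc hle' hl' (fun h ↦ ?_) (hcJ q (by simp)) hqc rfl)
    · rw [cs.isRightDescent_iff] at hup
      lia
    · have iu_eq : s i * u = u * s q := by simp [← conj_eq, mul_assoc]
      have := length_twistedConj_le hθ u (twistedConj θ (s q) x')
      rw [← twistedConj_mul, ← iu_eq, twistedConj_mul, length_ix] at this
      have := length_eq_of_isRightDescent hθ hx' h
      lia
  · have v_ascent : ¬ cs.IsLeftDescent v i := fun h ↦
      hxi (isRightDescent_of_length_eq hθ hc hlv h)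
    rw [cs.not_isLeftDescent_iff] at v_ascent
    have iv_eq : s i * v = u := eq_of_mem_parabolic_pair_of_length_twistedConj hθ hqc
      (mul_mem i_mem hv) hu (by rw [twistedConj_mul]; lia) hlu (by lia)
    refine hzi ?_
    rw [← iv_eq, twistedConj_mul]
    exact isRightDescent_twistedConj hθ hx hxi hxne

/-! ### The poset of twisted identities -/

theorem exists_covering_of_isRightDescent (hNOF : cs.IsNOF θ) (hθ : cs.IsInvolutiveAut θ)
    {x y z : W} {i : B} (hx : x ∈ twistedIdentities θ) (hy : y ∈ twistedIdentities θ)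
    (hz : z ∈ twistedIdentities θ) (hxi : cs.IsRightDescent x i) (hyi : cs.IsRightDescent y i)
    (hxz : cs.BruhatLE (twistedConj θ (s i) x) z) (hzy : cs.BruhatLE z (twistedConj θ (s i) y))
    (hl : ℓ z = ℓ (twistedConj θ (s i) x) + 2) :
    cs.BruhatLE x (twistedConj θ (s i) y) ∨
      ∃ z' ∈ twistedIdentities θ, cs.BruhatLE x z' ∧ cs.BruhatLE z' y ∧ ℓ z' = ℓ x + 2 := by
  by_cases hzi : cs.IsRightDescent z i
  · have := twistedConj_bruhatLE hθ hz hxz hzi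
    rw [twistedConj_simple_twistedConj_simple] at this
    exact .inl (this.trans hzy)
  have moved : twistedConj θ (s i) z ≠ z := fun hfix ↦
    twistedConj_ne_self_of_isRightDescent hθ hx hxi <| by
      simpa using (twistedConj_simple_eq_self_of_bruhatLE hNOF hθ (twistedConj_mem hx) hz hxz hl
        (not_isRightDescent_twistedConj hθ hx hxi) hzi hfix).symm
  refine .inr ⟨twistedConj θ (s i) z, twistedConj_mem hz, ?_, ?_, ?_⟩
  · simpa only [twistedConj_simple_twistedConj_simple] using
      twistedConj_bruhatLE_twistedConj_of_not_isRightDescent hθ hz hxz hzi moved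
  · exact twistedConj_bruhatLE hθ hy (hzy.trans (twistedConj_bruhatLE_self hθ hy hyi)) hyi
  · rw [length_twistedConj_of_not_isRightDescent hθ hz hzi moved, hl,
      ← length_eq_of_isRightDescent hθ hx hxi]

theorem exists_bruhatLE_of_bruhatLE (hNOF : cs.IsNOF θ) (hθ : cs.IsInvolutiveAut θ) {x y : W}
    (hx : x ∈ twistedIdentities θ) (hy : y ∈ twistedIdentities θ) (hle : cs.BruhatLE x y)
    (hne : x ≠ y) :
    ∃ z ∈ twistedIdentities θ, cs.BruhatLE x z ∧ cs.BruhatLE z y ∧ ℓ z = ℓ x + 2 := by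
  induction hn : ℓ y using Nat.strong_induction_on generalizing x y with
  | _ n ih =>
  subst hn
  have y_ne_one : y ≠ 1 := by
    rintro rfl
    exact hne (eq_of_bruhatLE_of_length_le hle (by simp))
  obtain ⟨i, hyi⟩ := cs.exists_rightDescent_of_ne_one y_ne_one
  have length_y := length_eq_of_isRightDescent hθ hy hyi
  have below : ∀ x ∈ twistedIdentities θ, cs.BruhatLE x (twistedConj θ (s i) y) →
      x ≠ twistedConj θ (s i) y → ∃ z ∈ twistedIdentities θ, cs.BruhatLE x z ∧
        cs.BruhatLE z (twistedConj θ (s i) y) ∧ ℓ z = ℓ x + 2 :=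
    fun x hx hle hne ↦ ih _ (by lia) hx (twistedConj_mem hy) hle hne rfl
  by_cases hxy : x = twistedConj θ (s i) y
  · exact ⟨y, hy, hle, .refl, by rw [length_y, ← hxy]⟩
  by_cases hxy' : cs.BruhatLE x (twistedConj θ (s i) y)
  · obtain ⟨z, hz, hxz, hzy, hl⟩ := below x hx hxy' hxy
    exact ⟨z, hz, hxz, hzy.trans (twistedConj_bruhatLE_self hθ hy hyi), hl⟩
  by_cases hxi : cs.IsRightDescent x i
  · obtain ⟨z, hz, hxz, hzy, hl⟩ := below _ (twistedConj_mem hx)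
      (twistedConj_bruhatLE_twistedConj_of_isRightDescent hθ hx hle hxi)
      ((twistedConj_injective _).ne hne)
    exact (exists_covering_of_isRightDescent hNOF hθ hx hy hz hxi hyi hxz hzy hl).resolve_left hxy'
  · exact absurd (bruhatLE_twistedConj hθ hx hle hxi) hxy'

theorem isSPM_restrict_Iic {P : Type*} [PartialOrder P] {m : P → P} (hinv : Function.Involutive m)
    (hcov : ∀ x, m x ⋖ x ∨ m x = x ∨ x ⋖ m x) (hlt : ∀ x y, x ⋖ y → m x ≠ y → m x < m y) {w : P}
    (hw : m w ⋖ w) (hmaps : Set.MapsTo m (Set.Iic w) (Set.Iic w)) : IsSPM (hmaps.restrict m) := by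
  have coe_covBy_coe : ∀ {x y : Set.Iic w}, (x : P) ⋖ y ↔ x ⋖ y :=
    Set.OrdConnected.apply_covBy_apply_iff (OrderEmbedding.subtype (· ≤ w))
      (Subtype.range_coe.symm ▸ Set.ordConnected_Iic)
  exact
    { involutive := fun x ↦ Subtype.ext (hinv x)
      top_covBy := coe_covBy_coe.mp hw
      covBy_or := fun x ↦ (hcov x).imp coe_covBy_coe.mp (.imp Subtype.ext coe_covBy_coe.mp)
      lt_of_covBy := fun x y hxy hne ↦
        hlt x y (coe_covBy_coe.mpr hxy) fun h ↦ hne (Subtype.ext h) }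

theorem br_length_lt {X : Set W} {x y : cs.Br X} (h : x < y) : ℓ x.val < ℓ y.val :=
  (CoxeterSystem.BruhatLE.eq_or_length_lt h.le).resolve_left
    fun h' ↦ h.ne (CoxeterSystem.Br.ext h')

theorem br_finite_Iic {X : Set W} (w : cs.Br X) : (Set.Iic w).Finite :=
  .of_injOn (f := CoxeterSystem.Br.val) (t := {u | cs.BruhatLE u w.val}) (fun _ hx ↦ hx)
    (fun _ _ _ _ h ↦ CoxeterSystem.Br.ext h) (finite_setOf_bruhatLE w.val)

/-- Twisted conjugation by `g`, as a map on the poset `Br(ι(θ))`. -/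
def brTwistedConj (cs : CoxeterSystem M W) (θ : W ≃* W) (g : W) (x : cs.Br (twistedIdentities θ)) :
    cs.Br (twistedIdentities θ) :=
  ⟨twistedConj θ g x.val, twistedConj_mem x.mem⟩

theorem brTwistedConj_involutive (i : B) : Function.Involutive (brTwistedConj cs θ (s i)) :=
  fun x ↦ CoxeterSystem.Br.ext (twistedConj_simple_twistedConj_simple i x.val)

theorem even_length_of_mem_twistedIdentities (hθ : cs.IsInvolutiveAut θ) {x : W}
    (hx : x ∈ twistedIdentities θ) : Even (ℓ x) := by
  obtain ⟨v, rfl⟩ := hx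
  have := cs.length_mul_mod_two (θ v) v⁻¹
  rw [length_map hθ, cs.length_inv] at this
  rw [Nat.even_iff]
  lia

theorem covBy_of_length_eq_add_two (hθ : cs.IsInvolutiveAut θ)
    {x y : cs.Br (twistedIdentities θ)} (hle : x ≤ y) (hl : ℓ y.val = ℓ x.val + 2) : x ⋖ y := by
  refine ⟨lt_of_le_of_ne hle ?_, fun z hxz hzy ↦ ?_⟩
  · rintro rfl
    lia
  · have h₁ := br_length_lt hxz
    have h₂ := br_length_lt hzy
    obtain ⟨a, ha⟩ := even_length_of_mem_twistedIdentities hθ x.mem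
    obtain ⟨b, hb⟩ := even_length_of_mem_twistedIdentities hθ z.mem
    lia

theorem length_eq_add_two_of_covBy (hNOF : cs.IsNOF θ) (hθ : cs.IsInvolutiveAut θ)
    {x y : cs.Br (twistedIdentities θ)} (h : x ⋖ y) : ℓ y.val = ℓ x.val + 2 := by
  obtain ⟨z, hz, hxz, hzy, hl⟩ := exists_bruhatLE_of_bruhatLE hNOF hθ x.mem y.mem h.le
    fun he ↦ h.ne (CoxeterSystem.Br.ext he)
  rcases h.eq_or_eq (c := ⟨z, hz⟩) hxz hzy with rfl | rfl
  · lia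
  · exact hl

theorem brTwistedConj_covBy (hθ : cs.IsInvolutiveAut θ) {x : cs.Br (twistedIdentities θ)} {i : B}
    (hi : cs.IsRightDescent x.val i) : brTwistedConj cs θ (s i) x ⋖ x :=
  covBy_of_length_eq_add_two hθ (twistedConj_bruhatLE_self hθ x.mem hi)
    (length_eq_of_isRightDescent hθ x.mem hi)

theorem brTwistedConj_covBy_or (hθ : cs.IsInvolutiveAut θ) (i : B)
    (x : cs.Br (twistedIdentities θ)) :
    brTwistedConj cs θ (s i) x ⋖ x ∨ brTwistedConj cs θ (s i) x = x ∨
      x ⋖ brTwistedConj cs θ (s i) x := by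
  by_cases hi : cs.IsRightDescent x.val i
  · exact .inl (brTwistedConj_covBy hθ hi)
  by_cases hfix : twistedConj θ (s i) x.val = x.val
  · exact .inr (.inl (CoxeterSystem.Br.ext hfix))
  · exact .inr (.inr (covBy_of_length_eq_add_two hθ (bruhatLE_twistedConj_self hθ x.mem hi)
      (length_twistedConj_of_not_isRightDescent hθ x.mem hi hfix)))

theorem brTwistedConj_lt_of_covBy (hNOF : cs.IsNOF θ) (hθ : cs.IsInvolutiveAut θ) (i : B)
    (x y : cs.Br (twistedIdentities θ)) (h : x ⋖ y) (hne : brTwistedConj cs θ (s i) x ≠ y) :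
    brTwistedConj cs θ (s i) x < brTwistedConj cs θ (s i) y := by
  have hle : cs.BruhatLE x.val y.val := h.le
  refine lt_of_le_of_ne ?_ ((brTwistedConj_involutive i).injective.ne h.ne)
  change cs.BruhatLE (twistedConj θ (s i) x.val) (twistedConj θ (s i) y.val)
  by_cases hx : cs.IsRightDescent x.val i
  · exact twistedConj_bruhatLE_twistedConj_of_isRightDescent hθ x.mem hle hx
  by_cases hy : cs.IsRightDescent y.val i
  · have fixed : twistedConj θ (s i) x.val = x.val :=
      congrArg CoxeterSystem.Br.val <|
        (h.eq_or_eq (c := brTwistedConj cs θ (s i) x) (bruhatLE_twistedConj_self hθ x.mem hx)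
          (twistedConj_bruhatLE hθ y.mem hle hy)).resolve_right hne
    rw [fixed]
    exact bruhatLE_twistedConj hθ x.mem hle hx
  by_cases hfix : twistedConj θ (s i) y.val = y.val
  · rwa [hfix, twistedConj_simple_eq_self_of_bruhatLE hNOF hθ x.mem y.mem hle
      (length_eq_add_two_of_covBy hNOF hθ h) hx hy hfix]
  · exact twistedConj_bruhatLE_twistedConj_of_not_isRightDescent hθ y.mem hle hy hfix

theorem mapsTo_brTwistedConj (hθ : cs.IsInvolutiveAut θ) {w : cs.Br (twistedIdentities θ)} {i : B}
    (hi : cs.IsRightDescent w.val i) :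
    Set.MapsTo (brTwistedConj cs θ (s i)) (Set.Iic w) (Set.Iic w) :=
  fun _ hx ↦ twistedConj_bruhatLE hθ w.mem hx hi

theorem isSPM_brTwistedConj (hNOF : cs.IsNOF θ) (hθ : cs.IsInvolutiveAut θ)
    {w : cs.Br (twistedIdentities θ)} {i : B} (hi : cs.IsRightDescent w.val i) :
    IsSPM ((mapsTo_brTwistedConj hθ hi).restrict (brTwistedConj cs θ (s i))) :=
  isSPM_restrict_Iic (brTwistedConj_involutive i) (brTwistedConj_covBy_or hθ i)
    (brTwistedConj_lt_of_covBy hNOF hθ i) (brTwistedConj_covBy hθ hi) _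

theorem exists_isRightDescent_of_not_isMin {X : Set W} {w : cs.Br X} (hw : ¬ IsMin w) :
    ∃ i, cs.IsRightDescent w.val i := by
  refine cs.exists_rightDescent_of_ne_one fun h ↦ hw fun y hy ↦ ?_
  have : y = w := CoxeterSystem.Br.ext (eq_of_bruhatLE_of_length_le hy (by simp [h]))
  exact this.ge

end CoxeterGroup

theorem mainTheorem3 {B W : Type*} [Group W] {M : CoxeterMatrix B} (cs : CoxeterSystem M W)
    (θ : W ≃* W) (hθ : cs.IsInvolutiveAut θ) (hNOF : cs.IsNOF θ) :
    IsPircon (cs.Br (twistedIdentities θ)) ∧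
      ∀ (w : cs.Br (twistedIdentities θ)) (i : B), cs.BruhatLT (w.val * cs.simple i) w.val →
        Finite (Set.Iic w) ∧
        ∃ m : Set.Iic w → Set.Iic w, IsSPM m ∧
          ∀ x : Set.Iic w, (m x).val.val = θ (cs.simple i) * x.val.val * cs.simple i := by
  refine ⟨fun w hw ↦ ?_, fun w i hlt ↦ ?_⟩
  · obtain ⟨i, hi⟩ := CoxeterGroup.exists_isRightDescent_of_not_isMin hw
    exact ⟨CoxeterGroup.br_finite_Iic w, _, CoxeterGroup.isSPM_brTwistedConj hNOF hθ hi⟩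
  · have hi : cs.IsRightDescent w.val i := hlt.1.eq_or_length_lt.resolve_left hlt.2
    exact ⟨CoxeterGroup.br_finite_Iic w, _, CoxeterGroup.isSPM_brTwistedConj hNOF hθ hi,
      fun x ↦ congrArg (θ (cs.simple i) * x.val.val * ·) (cs.inv_simple i)⟩
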